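/- Let $d\ge 2$ and let $\mathbb T_d$ be the homogeneous tree in which every vertex has $d+1$ neighbours. Consider the following frog model with removal on $\mathbb T_d$, with parameter $p\in(0,1)$. At time $0$ there is one particle at each vertex; the one at a fixed root is active and all the others are inactive. The particles have independent lifetimes $\mathcal T$ with $\mathbb P(\mathcal T=n)=(1-p)p^n$, $n\ge 0$, and independent simple random walks on $\mathbb T_d$. In each time step all active particles jump simultaneously, each along its own walk, except that a particle which has already made $\mathcal T$ steps is removed. A particle that jumps to a vertex whose particle was inactive before this time step activates that particle and stays active (also if several particles arrive there simultaneously); a particle that jumps to a vertex whose particle had been activated before this time step is removed (removal after $L=1$ unsuccessful jump). Newly activated particles start moving in the next time step. The process survives if at every time there is at least one active particle, and $p_c^{\mathrm r}(d)$ denotes the infimum of the $p\in(0,1)$ for which the probability of survival is positive. Then, for every $d\ge 2$, one has $p_c^{\mathrm r}(d)\in(0,1)$, and $p=p_c^{\mathrm r}(d)$ is the unique solution in $p\in\left(0,\frac{d+1}{d}\right)$ of $$\sum_{k\ge 1}(dq)^k\prod_{i=1}^{k-1}(1-q^i)=1,\qquad q=\frac{p}{d+1}.$$ Moreover $0.8\le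 p_c^{\mathrm r}(2)\le 0.831619$, and for every $d\ge 3$ $$\frac{d+1}{2d-\frac14}\;\le\; p_c^{\mathrm r}(d)\;\le\;\frac{(d+1)(7d-1)\left(1-\sqrt{1-\frac{14}{(7d-1)^2}}\right)}{2}.$$ -/

import Mathlib

open MeasureTheory ProbabilityTheory

noncomputable section

namespace FrogRemoval

/-- The vertices of the homogeneous tree of degree `d + 1`: finite words over `Fin (d + 1)` without
two equal consecutive letters. The root is the empty word. -/
abbrev Vertex (d : ℕ) : Type :=
  {w : List (Fin (d + 1)) // w.IsChain (fun a b => a ≠ b)}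

/-- The root of the tree. -/
def root (d : ℕ) : Vertex d := ⟨[], List.isChain_nil⟩

variable {d : ℕ}

/-- The neighbour of `v` in direction `i`: erase the first letter of `v` if it is `i` (a step towards
the root), otherwise put `i` in front of `v` (a step away from the root). -/
def neighbor (v : Vertex d) (i : Fin (d + 1)) : Vertex d :=
  if h : v.1.head? = some i then ⟨v.1.tail, v.2.tail⟩
  else ⟨i :: v.1, List.isChain_cons.2
    ⟨fun b hb hib => h (by rw [hib]; exact hb), v.2⟩⟩

lemma neighbor_val (v : Vertex d) (i : Fin (d + 1)) :
    (neighbor v i).1 = if v.1.head? = some i then v.1.tail else i :: v.1 := by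
  unfold neighbor; split_ifs <;> rfl

lemma neighbor_neighbor (v : Vertex d) (i : Fin (d + 1)) : neighbor (neighbor v i) i = v := by
  apply Subtype.ext
  obtain ⟨w, hw⟩ := v
  rw [neighbor_val, neighbor_val]
  cases w with
  | nil => simp
  | cons a l =>
    by_cases h : a = i
    · subst h
      have h1 : l.head? ≠ some a := fun h1 => (List.isChain_cons.1 hw).1 a h1 rfl
      simp [h1]
    · simp [h]

lemma neighbor_ne (v : Vertex d) (i : Fin (d + 1)) : neighbor v i ≠ v := by
  intro h
  have h2 := congrArg (fun u => u.1.length) h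
  simp only [neighbor_val] at h2
  obtain ⟨w, hw⟩ := v
  cases w with
  | nil => simp at h2
  | cons a l => by_cases h : a = i <;> simp [h] at h2

/-- The homogeneous tree `𝕋_d` of degree `d + 1`. -/
def tree (d : ℕ) : SimpleGraph (Vertex d) where
  Adj u v := ∃ i, neighbor u i = v
  symm := ⟨by rintro u v ⟨i, rfl⟩; exact ⟨i, neighbor_neighbor u i⟩⟩
  loopless := ⟨by rintro v ⟨i, hi⟩; exact neighbor_ne v i hi⟩

/-- Distinct directions lead to distinct neighbours, so every vertex has exactly `d + 1` neighbours,
and a uniform direction gives a uniform neighbour. -/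
lemma neighbor_injective (v : Vertex d) : Function.Injective (neighbor v) := by
  intro i j h
  have h2 := congrArg Subtype.val h
  simp only [neighbor_val] at h2
  obtain ⟨w, hw⟩ := v
  cases w with
  | nil => simpa using h2
  | cons a l =>
    by_cases hi : a = i <;> by_cases hj : a = j
    · exact hi.symm.trans hj
    · subst hi
      have := congrArg List.length h2
      simp [hj] at this; omega
    · subst hj
      have := congrArg List.length h2
      simp [hi] at this; omega
    · simpa [hi, hj] using h2

lemma neighborSet_eq (v : Vertex d) : (tree d).neighborSet v = Set.range (neighbor v) := rfl

lemma ncard_neighborSet (v : Vertex d) : ((tree d).neighborSet v).ncard = d + 1 := by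
  rw [neighborSet_eq, ← Set.image_univ, Set.ncard_image_of_injective _ (neighbor_injective v)]
  simp [Set.ncard_univ]

lemma val_eq_tail_of_adj {u v : Vertex d} (h : (tree d).Adj u v)
    (hl : v.1.length ≤ u.1.length) : v.1 = u.1.tail := by
  obtain ⟨i, rfl⟩ := h
  rw [neighbor_val] at hl ⊢
  split_ifs at hl ⊢ with h
  · rfl
  · simp at hl

lemma tree_isTree (d : ℕ) : (tree d).IsTree := by
  have : Nonempty (Vertex d) := ⟨root d⟩
  refine SimpleGraph.IsTree.mk ⟨?_⟩ ?_
  · have key : ∀ v : Vertex d, (tree d).Reachable v (root d) := by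
      rintro ⟨w, hw⟩
      induction w with
      | nil => exact SimpleGraph.Reachable.refl _
      | cons a l ih =>
        refine SimpleGraph.Reachable.trans (SimpleGraph.Adj.reachable ?_) (ih hw.tail)
        exact ⟨a, Subtype.ext (by simp [neighbor_val])⟩
    exact fun u v => (key u).trans (key v).symm
  · intro v c hc
    obtain ⟨u, hu, hmax⟩ := c.support.toFinset.exists_max_image (fun x => x.1.length)
      ⟨v, by simp⟩
    have hu' : u ∈ c.support := by simpa using hu
    have hc' := hc.rotate hu'
    have hmem : ∀ x ∈ (c.rotate u hu').support, x.1.length ≤ u.1.length := by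
      intro x hx
      refine hmax x ?_
      simpa using hx
    refine hc'.snd_ne_penultimate (Subtype.ext ?_)
    rw [val_eq_tail_of_adj ((c.rotate u hu').adj_snd hc'.not_nil)
        (hmem _ (SimpleGraph.Walk.getVert_mem_support _ _)),
      val_eq_tail_of_adj ((c.rotate u hu').adj_penultimate hc'.not_nil).symm
        (hmem _ (SimpleGraph.Walk.getVert_mem_support _ _))]

/-- The randomness of the model: each particle (named after its initial vertex) has a lifetime and an
infinite sequence of directions. -/
abbrev Outcome (d : ℕ) : Type := Vertex d → ℕ × (ℕ → Fin (d + 1))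

/-- The law of the randomness: all lifetimes and all directions are independent, the lifetimes are
geometric with parameter `1 - p`, i.e. `ℙ(lifetime = n) = (1 - p) * p ^ n` for `n ≥ 0`, and the
directions are uniform. -/
def law (d : ℕ) (p : unitInterval) : Measure (Outcome d) :=
  Measure.infinitePi fun _ : Vertex d =>
    (geometricMeasure (unitInterval.symm p)).prod
      (Measure.infinitePi fun _ : ℕ => uniformOn (Set.univ : Set (Fin (d + 1))))

/-- The number of steps that the particle `x` can make. -/
def lifetime (ω : Outcome d) (x : Vertex d) : ℕ := (ω x).1

/-- The simple random walk of the particle `x`: its position after `n` steps. -/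
def walk (ω : Outcome d) (x : Vertex d) : ℕ → Vertex d
  | 0 => x
  | n + 1 => neighbor (walk ω x n) ((ω x).2 n)

/-- A state of the system. -/
structure State (d : ℕ) where
  /-- the vertices whose particle has already been activated -/
  visited : Set (Vertex d)
  /-- the pairs `(x, n)` such that particle `x` is active and has made `n` steps so far -/
  active : Set (Vertex d × ℕ)

/-- At time `0` only the particle at the root is active. -/
def initialState (d : ℕ) : State d := ⟨{root d}, {(root d, 0)}⟩

/-- The vertices to which active particles jump in the next time step: a particle that has not yet
reached the end of its lifetime jumps, the others are removed. -/
def jumpTargets (ω : Outcome d) (s : State d) : Set (Vertex d) :=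
  {y | ∃ x n, (x, n) ∈ s.active ∧ n < lifetime ω x ∧ walk ω x (n + 1) = y}

/-- One time step. All surviving active particles jump simultaneously. A particle that jumps to a
vertex whose own particle was inactive before the jump activates it and stays in the system; a particle
that jumps to a vertex whose own particle had been activated before is removed. -/
def step (ω : Outcome d) (s : State d) : State d where
  visited := s.visited ∪ jumpTargets ω s
  active :=
    {a | ∃ x n, (x, n) ∈ s.active ∧ n < lifetime ω x ∧ walk ω x (n + 1) ∉ s.visited ∧
      a = (x, n + 1)} ∪
    {a | ∃ y ∈ jumpTargets ω s, y ∉ s.visited ∧ a = (y, 0)}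

/-- The state of the system at time `t`. -/
def stateAt (ω : Outcome d) : ℕ → State d
  | 0 => initialState d
  | t + 1 => step ω (stateAt ω t)

/-- The event of survival: at every time there is at least one active particle. -/
def survival (d : ℕ) : Set (Outcome d) := {ω | ∀ t, (stateAt ω t).active.Nonempty}

/-- The probability of survival. -/
def survivalProb (d : ℕ) (p : unitInterval) : ℝ := (law d p).real (survival d)

/-- The critical parameter `p_c^r(d)`. -/
def criticalParameter (d : ℕ) : ℝ :=
  sInf {x : ℝ | ∃ p : unitInterval, (p : ℝ) = x ∧ 0 < x ∧ x < 1 ∧ 0 < survivalProb d p}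

/-- The equation `∑_{k ≥ 1} c (d q)^k ∏_{i=1}^{k-1} (1 - c q^i) = 1` (the series converges, with
sum `1`); the index is shifted, `k = j + 1`. -/
def LocalizationEq (d : ℕ) (c q : ℝ) : Prop :=
  HasSum (fun j : ℕ => c * ((d : ℝ) * q) ^ (j + 1) * ∏ i ∈ Finset.Icc 1 j, (1 - c * q ^ i)) 1

end FrogRemoval

end

/-!
A particle that steps back towards the root enters a vertex that has already been visited and is
removed. Hence only the particles that always step away from the root matter, and the numbers of
such particles that reach the vertices form a branching process with types: if `k` particles reach
`v`, then `N ∼ Bin(k, q)` of them continue to a given child, `q = p / (d + 1)`, and the child is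
reached by `N + 1` particles, or by none if `N = 0`.

The functions `h_u(k) = 1 - (1 - u) ^ k` diagonalise the mean operator almost completely: the
expectation of `h_u` at a child is `u * h_q + (1 - u) * h_{q u}`. Therefore
`f = ∑ i, d ^ i * (q; q)_i * h_{q ^ (i + 1)}` satisfies `d * E f(child) = f + (S - 1) * h_q`, where
`S` is the series of the theorem. If `S < 1`, then iterating from the root shows that the expected
number of visited vertices is finite. If `S > 1`, then a truncation of `f` is expanded by the mean
operator, and for small `θ` the product of `1 - θ f` over the vertices of a level is a
supermartingale, which bounds the probability of extinction away from `1`.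

As `S` is continuous and strictly increasing in `q`, the critical parameter corresponds to its
unique solution of `S = 1`, and the numerical bounds follow from partial sums of the series.
-/

namespace FrogRemoval

/-! ### The localization series -/

/-- The `q`-Pochhammer symbol `(q; q)_n = ∏_{i=1}^n (1 - q ^ i)`. -/
noncomputable def qPochhammer (q : ℝ) (n : ℕ) : ℝ :=
  ∏ i ∈ Finset.Icc 1 n, (1 - q ^ i)

section QPochhammer

variable {q : ℝ}

lemma qPochhammer_zero (q : ℝ) : qPochhammer q 0 = 1 := by simp [qPochhammer]

lemma qPochhammer_succ (q : ℝ) (n : ℕ) :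
    qPochhammer q (n + 1) = qPochhammer q n * (1 - q ^ (n + 1)) :=
  Finset.prod_Icc_succ_top (by omega) _

lemma qPochhammer_two (q : ℝ) : qPochhammer q 2 = (1 - q) * (1 - q ^ 2) := by
  simp [qPochhammer_succ, qPochhammer_zero]

lemma qPochhammer_nonneg (h0 : 0 ≤ q) (h1 : q ≤ 1) (n : ℕ) : 0 ≤ qPochhammer q n :=
  Finset.prod_nonneg fun _ _ => sub_nonneg.2 (pow_le_one₀ h0 h1)

lemma antitone_qPochhammer (h0 : 0 ≤ q) (h1 : q ≤ 1) : Antitone (qPochhammer q) :=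
  antitone_nat_of_succ_le fun n => by
    rw [qPochhammer_succ]
    exact mul_le_of_le_one_right (qPochhammer_nonneg h0 h1 n) (by linarith [pow_nonneg h0 (n + 1)])

lemma qPochhammer_le_one (h0 : 0 ≤ q) (h1 : q ≤ 1) (n : ℕ) : qPochhammer q n ≤ 1 :=
  (antitone_qPochhammer h0 h1 n.zero_le).trans_eq (qPochhammer_zero q)

/-- The bound that is needed is `1 - q - q ^ 2`; the term `q ^ (n + 3)` makes the induction work. -/
lemma le_qPochhammer_add_two (h0 : 0 ≤ q) (h1 : q ≤ 1) (n : ℕ) :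
    1 - q - q ^ 2 + q ^ (n + 3) ≤ qPochhammer q (n + 2) := by
  induction n with
  | zero => rw [qPochhammer_two]; exact le_of_eq (by ring)
  | succ n ih =>
    have hle : q ^ (n + 3) ≤ q ^ 2 := pow_le_pow_of_le_one h0 h1 (by omega)
    calc 1 - q - q ^ 2 + q ^ (n + 1 + 3)
        ≤ 1 - q - q ^ 2 + q ^ (n + 1 + 3) + q ^ (n + 3) * (q ^ 2 - q ^ (n + 3)) :=
          le_add_of_nonneg_right (mul_nonneg (by positivity) (sub_nonneg.2 hle))
      _ = (1 - q - q ^ 2 + q ^ (n + 3)) * (1 - q ^ (n + 3)) := by ring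
      _ ≤ qPochhammer q (n + 2) * (1 - q ^ (n + 3)) :=
          mul_le_mul_of_nonneg_right ih (sub_nonneg.2 (pow_le_one₀ h0 h1))
      _ = qPochhammer q (n + 1 + 2) := (qPochhammer_succ q (n + 2)).symm

end QPochhammer

/-- The `j`-th term `(b q) ^ (j + 1) * (q; q)_j` of the localization series, with a real branching
number `b`; the paper's series has `b = d` and its summation index is `k = j + 1`. -/
noncomputable def localizationTerm (b q : ℝ) (j : ℕ) : ℝ :=
  (b * q) ^ (j + 1) * qPochhammer q j

/-- The sum of the localization series, meaningful for `0 ≤ b * q < 1`. -/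
noncomputable def localizationSum (b q : ℝ) : ℝ := ∑' j, localizationTerm b q j

section Localization

variable {b q : ℝ}

lemma localizationTerm_zero (b q : ℝ) : localizationTerm b q 0 = b * q := by
  simp [localizationTerm, qPochhammer_zero]

lemma localizationTerm_succ (b q : ℝ) (j : ℕ) :
    localizationTerm b q (j + 1) = localizationTerm b q j * (b * (q * (1 - q ^ (j + 1)))) := by
  simp only [localizationTerm, qPochhammer_succ]
  ring

lemma localizationTerm_nonneg (hb : 0 ≤ b) (h0 : 0 ≤ q) (h1 : q ≤ 1) (j : ℕ) :
    0 ≤ localizationTerm b q j :=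
  mul_nonneg (by positivity) (qPochhammer_nonneg h0 h1 j)

lemma summable_localizationTerm (hb : 1 ≤ b) (h0 : 0 ≤ q) (hbq : b * q < 1) :
    Summable (localizationTerm b q) := by
  have hb0 : 0 ≤ b := zero_le_one.trans hb
  have h1 : q ≤ 1 := by nlinarith
  refine Summable.of_nonneg_of_le (localizationTerm_nonneg hb0 h0 h1)
    (fun j => mul_le_of_le_one_right (by positivity) (qPochhammer_le_one h0 h1 j)) ?_
  exact (summable_nat_add_iff 1).2 (summable_geometric_of_lt_one (by positivity) hbq)

lemma localizationEq_one_iff {d : ℕ} (hd : 1 ≤ d) (h0 : 0 ≤ q) (hdq : (d : ℝ) * q < 1) :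
    LocalizationEq d 1 q ↔ localizationSum d q = 1 := by
  have hterm : LocalizationEq d 1 q ↔ HasSum (localizationTerm d q) 1 := by
    unfold LocalizationEq localizationTerm qPochhammer
    simp
  rw [hterm, (summable_localizationTerm (by exact_mod_cast hd) h0 hdq).hasSum_iff]
  rfl

lemma mul_one_sub_pow_mono {x y : ℝ} (hx : 0 ≤ x) (hxy : x ≤ y) (hy : y ≤ 1 / 2) (n : ℕ) :
    x * (1 - x ^ (n + 1)) ≤ y * (1 - y ^ (n + 1)) := by
  have hy0 : 0 ≤ y := hx.trans hxy
  have hn : ((n + 2 : ℕ) : ℝ) ≤ 2 ^ (n + 1) := by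
    exact_mod_cast Nat.lt_two_pow_self (n := n + 1)
  have hsub : y ^ (n + 2) - x ^ (n + 2) ≤ y - x :=
    calc y ^ (n + 2) - x ^ (n + 2)
        ≤ |y - x| * (n + 2 : ℕ) * max |y| |x| ^ (n + 1) :=
          (le_abs_self _).trans (abs_pow_sub_pow_le y x (n + 2))
      _ = (y - x) * ((n + 2 : ℕ) * y ^ (n + 1)) := by
          rw [abs_of_nonneg (sub_nonneg.2 hxy), abs_of_nonneg hy0, abs_of_nonneg hx,
            max_eq_left hxy, mul_assoc]
      _ ≤ (y - x) * (2 ^ (n + 1) * (1 / 2) ^ (n + 1)) := by gcongr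
      _ = y - x := by rw [← mul_pow]; norm_num
  calc x * (1 - x ^ (n + 1)) = x - x ^ (n + 2) := by ring
    _ ≤ y - y ^ (n + 2) := by linarith
    _ = y * (1 - y ^ (n + 1)) := by ring

lemma localizationTerm_mono (hb : 0 ≤ b) {x y : ℝ} (hx : 0 ≤ x) (hxy : x ≤ y) (hy : y ≤ 1 / 2)
    (j : ℕ) : localizationTerm b x j ≤ localizationTerm b y j := by
  induction j with
  | zero => rw [localizationTerm_zero, localizationTerm_zero]; gcongr
  | succ j ih =>
    have hx1 : x ≤ 1 := by linarith
    have hfactor : 0 ≤ x * (1 - x ^ (j + 1)) := mul_nonneg hx (sub_nonneg.2 (pow_le_one₀ hx hx1))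
    rw [localizationTerm_succ, localizationTerm_succ]
    exact mul_le_mul ih (mul_le_mul_of_nonneg_left (mul_one_sub_pow_mono hx hxy hy j) hb)
      (mul_nonneg hb hfactor) ((localizationTerm_nonneg hb hx hx1 j).trans ih)

lemma localizationSum_strictMono (hb : 2 ≤ b) {x y : ℝ} (hx : 0 ≤ x) (hxy : x < y)
    (hby : b * y < 1) : localizationSum b x < localizationSum b y := by
  refine Summable.tsum_lt_tsum (i := 0)
    (localizationTerm_mono (by linarith) hx hxy.le (by nlinarith)) ?_
    (summable_localizationTerm (by linarith) hx (by nlinarith))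
    (summable_localizationTerm (by linarith) (hx.trans hxy.le) hby)
  rw [localizationTerm_zero, localizationTerm_zero]
  gcongr

lemma continuousOn_localizationSum (hb : 2 ≤ b) {y : ℝ} (hy : 0 ≤ y) (hby : b * y < 1) :
    ContinuousOn (localizationSum b) (Set.Icc 0 y) := by
  have hy2 : y ≤ 1 / 2 := by nlinarith
  refine continuousOn_tsum (u := localizationTerm b y) (fun j => ?_)
    (summable_localizationTerm (by linarith) hy hby) fun j x hx => ?_
  · unfold localizationTerm qPochhammer; fun_prop
  · rw [Real.norm_of_nonneg (localizationTerm_nonneg (by linarith) hx.1 (by linarith [hx.2]) j)]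
    exact localizationTerm_mono (by linarith) hx.1 hx.2 hy2 j

lemma exists_localizationSum_eq_one (hb : 2 ≤ b) {x y : ℝ} (hx : 0 ≤ x) (hxy : x ≤ y)
    (hby : b * y < 1) (h₁ : localizationSum b x ≤ 1) (h₂ : 1 ≤ localizationSum b y) :
    ∃ q ∈ Set.Icc x y, localizationSum b q = 1 :=
  intermediate_value_Icc hxy
    ((continuousOn_localizationSum hb (hx.trans hxy) hby).mono (Set.Icc_subset_Icc_left hx))
    ⟨h₁, h₂⟩

lemma localizationSum_eq_add_tsum (hb : 1 ≤ b) (h0 : 0 ≤ q) (hbq : b * q < 1) :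
    localizationSum b q
      = b * q + (b * q) ^ 2 * (1 - q) + ∑' j, localizationTerm b q (j + 2) := by
  rw [localizationSum, ← (summable_localizationTerm hb h0 hbq).sum_add_tsum_nat_add 2]
  simp [Finset.sum_range_succ, localizationTerm, qPochhammer_succ, qPochhammer_zero]

lemma hasSum_const_mul_pow_add_three {x : ℝ} (c : ℝ) (h0 : 0 ≤ x) (h1 : x < 1) :
    HasSum (fun j : ℕ => x ^ (j + 3) * c) (c * (x ^ 3 / (1 - x))) := by
  have hgeom := (hasSum_geometric_of_lt_one h0 h1).mul_left (c * x ^ 3)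
  rw [← div_eq_mul_inv, mul_div_assoc] at hgeom
  exact hgeom.congr_fun fun j => by ring

lemma localizationSum_le (hb : 1 ≤ b) (h0 : 0 ≤ q) (hbq : b * q < 1) :
    localizationSum b q ≤ b * q + (b * q) ^ 2 * (1 - q)
      + (1 - q) * (1 - q ^ 2) * ((b * q) ^ 3 / (1 - b * q)) := by
  have hbq0 : 0 ≤ b * q := by positivity
  have hq1 : q ≤ 1 := by nlinarith
  have hmajorant := hasSum_const_mul_pow_add_three ((1 - q) * (1 - q ^ 2)) hbq0 hbq
  rw [localizationSum_eq_add_tsum hb h0 hbq, ← hmajorant.tsum_eq]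
  gcongr with j
  · exact (summable_nat_add_iff 2).2 (summable_localizationTerm hb h0 hbq)
  · exact hmajorant.summable
  · rw [localizationTerm, ← qPochhammer_two]
    gcongr
    exact antitone_qPochhammer h0 hq1 (Nat.le_add_left 2 j)

lemma le_localizationSum (hb : 1 ≤ b) (h0 : 0 ≤ q) (hbq : b * q < 1) :
    b * q + (b * q) ^ 2 * (1 - q) + (1 - q - q ^ 2) * ((b * q) ^ 3 / (1 - b * q))
      ≤ localizationSum b q := by
  have hbq0 : 0 ≤ b * q := by positivity
  have hq1 : q ≤ 1 := by nlinarith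
  have hminorant := hasSum_const_mul_pow_add_three (1 - q - q ^ 2) hbq0 hbq
  rw [localizationSum_eq_add_tsum hb h0 hbq, ← hminorant.tsum_eq]
  gcongr with j
  · exact hminorant.summable
  · exact (summable_nat_add_iff 2).2 (summable_localizationTerm hb h0 hbq)
  · rw [localizationTerm]
    gcongr
    linarith [le_qPochhammer_add_two h0 hq1 j, pow_nonneg h0 (j + 3)]

lemma exists_localizationSum_two_eq_one :
    ∃ q ∈ Set.Icc (4 / 15 : ℝ) (0.831619 / 3), localizationSum 2 q = 1 := by
  refine exists_localizationSum_eq_one le_rfl (by norm_num) (by norm_num) (by norm_num) ?_ ?_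
  · exact (localizationSum_le (by norm_num) (by norm_num) (by norm_num)).trans (by norm_num)
  · exact le_trans (by norm_num) (le_localizationSum (by norm_num) (by norm_num) (by norm_num))

lemma localizationSum_le_one_of_mul_eq (h0 : 0 ≤ q) (h1 : q ≤ 1) (hb : 1 ≤ b)
    (hbq : b * q = 1 / 2 + q / 8) : localizationSum b q ≤ 1 := by
  refine (localizationSum_le hb h0 (by linarith)).trans ?_
  have hpow : ∀ n, q ^ n ≤ 1 := fun n => pow_le_one₀ h0 h1
  have hgap : 0 ≤ q ^ 2 *
      (1 / 4 - 1 / 64 * q - 9 / 128 * q ^ 2 - 11 / 512 * q ^ 3 - 1 / 512 * q ^ 4) :=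
    mul_nonneg (by positivity) (by linarith [hpow 2, hpow 3, hpow 4])
  rw [hbq, ← le_sub_iff_add_le', mul_div_assoc', div_le_iff₀ (by linarith)]
  linear_combination hgap

lemma one_le_localizationSum_of_mul_eq (h0 : 0 ≤ q) (h1 : q ≤ 3 / 16) (hb : 1 ≤ b)
    (hbq : b * q = 1 / 2 + q / 7 + q ^ 2 / 7) : 1 ≤ localizationSum b q := by
  have hpow : ∀ n, q ^ (n + 2) ≤ 9 / 256 * q ^ n := fun n =>
    calc q ^ (n + 2) = q ^ 2 * q ^ n := by ring
      _ ≤ (3 / 16) ^ 2 * q ^ n := by gcongr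
      _ = 9 / 256 * q ^ n := by norm_num
  have hsq : q ^ 2 ≤ 9 / 256 := by simpa using hpow 0
  refine le_trans ?_ (le_localizationSum hb h0 (by linarith))
  have hgap : 0 ≤ q * (1 / 28 + 1 / 56 * q - 53 / 196 * q ^ 2 - 5 / 28 * q ^ 3
      - 29 / 343 * q ^ 4 - 27 / 686 * q ^ 5 - 3 / 343 * q ^ 6 - 1 / 343 * q ^ 7) :=
    mul_nonneg h0 (by linarith [hpow 1, hpow 2, hpow 3, hpow 4, hpow 5])
  rw [hbq, ← sub_le_iff_le_add', mul_div_assoc', le_div_iff₀ (by linarith)]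
  linear_combination hgap

/-- The smaller root of `2 q² - 2 (7 b - 1) q + 7 = 0`, that is, of
`b q = 1 / 2 + q / 7 + q² / 7`. -/
noncomputable def upperRoot (b : ℝ) : ℝ :=
  (7 * b - 1) * (1 - √(1 - 14 / (7 * b - 1) ^ 2)) / 2

lemma upperRoot_pos (hb : 3 ≤ b) : 0 < upperRoot b := by
  have hm : 0 < 7 * b - 1 := by linarith
  have hsqrt : √(1 - 14 / (7 * b - 1) ^ 2) < 1 :=
    (Real.sqrt_lt' one_pos).2 (by rw [one_pow]; exact sub_lt_self _ (by positivity))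
  have : 0 < 1 - √(1 - 14 / (7 * b - 1) ^ 2) := sub_pos.2 hsqrt
  unfold upperRoot
  positivity

lemma upperRoot_le (hb : 3 ≤ b) : upperRoot b ≤ 3 / 16 := by
  obtain ⟨m, hm⟩ : ∃ m, m = 7 * b - 1 := ⟨_, rfl⟩
  have hm0 : 0 < m := by linarith
  have hsqrt : 1 - 3 / (8 * m) ≤ √(1 - 14 / m ^ 2) := by
    refine Real.le_sqrt_of_sq_le (sub_nonneg.1 ?_)
    have hdiff : 1 - 14 / m ^ 2 - (1 - 3 / (8 * m)) ^ 2 = (48 * m - 905) / (64 * m ^ 2) := by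
      field_simp
      ring
    rw [hdiff]
    exact div_nonneg (by linarith) (by positivity)
  calc upperRoot b = m * (1 - √(1 - 14 / m ^ 2)) / 2 := by rw [hm, upperRoot]
    _ ≤ m * (3 / (8 * m)) / 2 := by gcongr; linarith
    _ = 3 / 16 := by field_simp; norm_num

lemma mul_upperRoot (hb : 3 ≤ b) :
    b * upperRoot b = 1 / 2 + upperRoot b / 7 + upperRoot b ^ 2 / 7 := by
  have hm : 20 ≤ 7 * b - 1 := by linarith
  have hrad : 14 / (7 * b - 1) ^ 2 ≤ 1 := (div_le_one (by positivity)).2 (by nlinarith)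
  have hsq : (7 * b - 1) ^ 2 * √(1 - 14 / (7 * b - 1) ^ 2) ^ 2 = (7 * b - 1) ^ 2 - 14 := by
    rw [Real.sq_sqrt (by linarith)]
    field_simp
  unfold upperRoot
  linear_combination (-1 / 28 : ℝ) * hsq

lemma add_one_mul_upperRoot_lt_one (hb : 3 ≤ b) : (b + 1) * upperRoot b < 1 := by
  nlinarith [upperRoot_pos hb, upperRoot_le hb, mul_upperRoot hb]

lemma exists_localizationSum_eq_one_of_three_le (hb : 3 ≤ b) :
    ∃ q ∈ Set.Icc (1 / (2 * b - 1 / 4)) (upperRoot b), localizationSum b q = 1 := by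
  have hroot0 := upperRoot_pos hb
  have hroot1 := upperRoot_le hb
  have hroot := mul_upperRoot hb
  have hpos : 0 < 2 * b - 1 / 4 := by linarith
  have hlow : b * (1 / (2 * b - 1 / 4)) = 1 / 2 + 1 / (2 * b - 1 / 4) / 8 := by
    linear_combination mul_one_div_cancel hpos.ne' / 2
  have hlow1 : 1 / (2 * b - 1 / 4) ≤ 1 := (div_le_one hpos).2 (by linarith)
  refine exists_localizationSum_eq_one (by linarith) (by positivity) ?_ (by nlinarith)
    (localizationSum_le_one_of_mul_eq (by positivity) hlow1 (by linarith) hlow)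
    (one_le_localizationSum_of_mul_eq hroot0.le hroot1 (by linarith) hroot)
  rw [div_le_iff₀ hpos]
  nlinarith

end Localization

/-! ### The eigenfunction of the mean operator -/

/-- The coefficients `b ^ i * (q; q)_i` of the formal eigenfunction
`f k = ∑ i, b ^ i * (q; q)_i * (1 - (1 - q ^ (i + 1)) ^ k)` of the mean operator. -/
noncomputable def eigenCoeff (b q : ℝ) (i : ℕ) : ℝ := b ^ i * qPochhammer q i

section EigenCoeff

variable {b q : ℝ}

lemma eigenCoeff_zero (b q : ℝ) : eigenCoeff b q 0 = 1 := by
  simp [eigenCoeff, qPochhammer_zero]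

lemma eigenCoeff_succ (b q : ℝ) (i : ℕ) :
    eigenCoeff b q (i + 1) = b * (eigenCoeff b q i * (1 - q ^ (i + 1))) := by
  simp only [eigenCoeff, qPochhammer_succ]
  ring

lemma localizationTerm_eq_eigenCoeff (b q : ℝ) (i : ℕ) :
    localizationTerm b q i = b * (eigenCoeff b q i * q ^ (i + 1)) := by
  simp only [eigenCoeff, localizationTerm]
  ring

lemma eigenCoeff_nonneg (hb : 0 ≤ b) (h0 : 0 ≤ q) (h1 : q ≤ 1) (i : ℕ) : 0 ≤ eigenCoeff b q i :=
  mul_nonneg (by positivity) (qPochhammer_nonneg h0 h1 i)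

end EigenCoeff

/-- The expectation of `1 - (1 - u) ^ k`, where `k` is the number of particles that reach a given
vertex at distance `n` from the root without ever stepping back, when each surviving step of a
particle goes in a given direction with probability `q`. The recursion conditions on the last step,
see `integral_hitProb_card_occupants`. -/
def meanHit (q : ℝ) : ℕ → ℝ → ℝ
  | 0, u => u
  | n + 1, u => u * meanHit q n q + (1 - u) * meanHit q n (q * u)

section MeanHit

variable {b q : ℝ}

lemma meanHit_nonneg (h0 : 0 ≤ q) (h1 : q ≤ 1) (n : ℕ) {u : ℝ} (hu0 : 0 ≤ u) (hu1 : u ≤ 1) :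
    0 ≤ meanHit q n u := by
  induction n generalizing u with
  | zero => exact hu0
  | succ n ih =>
    exact add_nonneg (mul_nonneg hu0 (ih h0 h1))
      (mul_nonneg (sub_nonneg.2 hu1) (ih (mul_nonneg h0 hu0) (mul_le_one₀ h1 hu0 hu1)))

lemma hasSum_eigenCoeff_mul_meanHit (hb : 1 ≤ b) (h0 : 0 ≤ q) (hbq : b * q < 1) (n : ℕ) :
    HasSum (fun i => eigenCoeff b q i * (b ^ n * meanHit q n (q ^ (i + 1))))
      (localizationSum b q / b
        - (1 - localizationSum b q) * ∑ k ∈ Finset.range n, b ^ k * meanHit q k q) := by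
  have hb0 : b ≠ 0 := by linarith
  have hsum := (summable_localizationTerm hb h0 hbq).hasSum
  rw [← localizationSum] at hsum
  induction n with
  | zero =>
    simp only [Finset.range_zero, Finset.sum_empty, mul_zero, sub_zero]
    refine (hsum.div_const b).congr_fun fun i => ?_
    rw [localizationTerm_eq_eigenCoeff, mul_div_cancel_left₀ _ hb0, pow_zero, one_mul, meanHit]
  | succ n ih =>
    have hhead := hsum.mul_right (b ^ n * meanHit q n q)
    have htail := (hasSum_nat_add_iff' 1).2 ih
    rw [Finset.sum_range_one, eigenCoeff_zero, zero_add, pow_one, one_mul] at htail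
    rw [Finset.sum_range_succ, show ∀ s t x y : ℝ, s - (1 - t) * (x + y) = t * y
      + (s - (1 - t) * x - y) by intros; ring]
    refine (hhead.add htail).congr_fun fun i => ?_
    rw [localizationTerm_eq_eigenCoeff, eigenCoeff_succ, meanHit, pow_succ' q (i + 1)]
    ring

lemma tendsto_pow_mul_meanHit (hb : 1 ≤ b) (h0 : 0 ≤ q) (hbq : b * q < 1)
    (hsub : localizationSum b q < 1) :
    Filter.Tendsto (fun n => b ^ n * meanHit q n q) Filter.atTop (nhds 0) := by
  have h1 : q ≤ 1 := by nlinarith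
  have hpow (i : ℕ) : 0 ≤ q ^ (i + 1) ∧ q ^ (i + 1) ≤ 1 := ⟨by positivity, pow_le_one₀ h0 h1⟩
  refine Summable.tendsto_atTop_zero (summable_of_sum_range_le
    (c := localizationSum b q / b / (1 - localizationSum b q))
    (fun n => mul_nonneg (by positivity) (meanHit_nonneg h0 h1 n h0 h1)) fun n => ?_)
  have hnonneg := (hasSum_eigenCoeff_mul_meanHit hb h0 hbq n).nonneg fun i =>
    mul_nonneg (eigenCoeff_nonneg (by linarith) h0 h1 i)
      (mul_nonneg (by positivity) (meanHit_nonneg h0 h1 n (hpow i).1 (hpow i).2))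
  rw [le_div_iff₀' (sub_pos.2 hsub)]
  linarith

end MeanHit

/-- The probability that at least one of `k` particles is marked, when each is marked independently
with probability `u`. -/
def hitProb (u : ℝ) (k : ℕ) : ℝ := 1 - (1 - u) ^ k

section Hit

variable {u : ℝ}

lemma hitProb_nonneg (h0 : 0 ≤ u) (h1 : u ≤ 1) (k : ℕ) : 0 ≤ hitProb u k :=
  sub_nonneg.2 (pow_le_one₀ (by linarith) (by linarith))

lemma hitProb_le_one (h1 : u ≤ 1) (k : ℕ) : hitProb u k ≤ 1 :=
  sub_le_self _ (pow_nonneg (by linarith) _)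

lemma hitProb_zero (u : ℝ) : hitProb u 0 = 0 := by simp [hitProb]

lemma hitProb_one (u : ℝ) : hitProb u 1 = u := by simp [hitProb]

lemma le_hitProb (h0 : 0 ≤ u) (h1 : u ≤ 1) {k : ℕ} (hk : k ≠ 0) : u ≤ hitProb u k := by
  have := pow_le_of_le_one (by linarith : 0 ≤ 1 - u) (by linarith) hk
  unfold hitProb
  linarith

end Hit

/-- The eigenfunction truncated after `m` terms. -/
noncomputable def eigenFun (b q : ℝ) (m k : ℕ) : ℝ :=
  ∑ i ∈ Finset.range m, eigenCoeff b q i * hitProb (q ^ (i + 1)) k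

/-- The expected value of `eigenFun b q m` at the number of particles at a child of a vertex with
`k` particles. -/
noncomputable def meanEigenFun (b q : ℝ) (m k : ℕ) : ℝ :=
  ∑ i ∈ Finset.range m, eigenCoeff b q i *
    (q ^ (i + 1) * hitProb q k + (1 - q ^ (i + 1)) * hitProb (q * q ^ (i + 1)) k)

section EigenFun

variable {b q : ℝ}

lemma mul_meanEigenFun (b q : ℝ) (m k : ℕ) :
    b * meanEigenFun b q m k = eigenFun b q m k
      + (∑ i ∈ Finset.range m, localizationTerm b q i - 1) * hitProb q k
      + eigenCoeff b q m * hitProb (q ^ (m + 1)) k := by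
  have hmean : b * meanEigenFun b q m k =
      (∑ i ∈ Finset.range m, localizationTerm b q i) * hitProb q k
        + ∑ i ∈ Finset.range m, eigenCoeff b q (i + 1) * hitProb (q ^ (i + 2)) k := by
    rw [meanEigenFun, Finset.mul_sum, Finset.sum_mul, ← Finset.sum_add_distrib]
    refine Finset.sum_congr rfl fun i _ => ?_
    rw [eigenCoeff_succ, localizationTerm_eq_eigenCoeff, ← pow_succ']
    ring
  have hshift := Finset.sum_range_succ (fun i => eigenCoeff b q i * hitProb (q ^ (i + 1)) k) m
  rw [Finset.sum_range_succ'] at hshift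
  simp only [eigenCoeff_zero, zero_add, pow_one, one_mul] at hshift
  rw [hmean, eigenFun]
  linarith

lemma eigenFun_nonneg (hb : 0 ≤ b) (h0 : 0 ≤ q) (h1 : q ≤ 1) (m k : ℕ) :
    0 ≤ eigenFun b q m k :=
  Finset.sum_nonneg fun i _ => mul_nonneg (eigenCoeff_nonneg hb h0 h1 i)
    (hitProb_nonneg (by positivity) (pow_le_one₀ h0 h1) k)

lemma meanEigenFun_nonneg (hb : 0 ≤ b) (h0 : 0 ≤ q) (h1 : q ≤ 1) (m k : ℕ) :
    0 ≤ meanEigenFun b q m k := by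
  refine Finset.sum_nonneg fun i _ => mul_nonneg (eigenCoeff_nonneg hb h0 h1 i) ?_
  have hpow0 : 0 ≤ q ^ (i + 1) := by positivity
  have hpow1 : q ^ (i + 1) ≤ 1 := pow_le_one₀ h0 h1
  exact add_nonneg (mul_nonneg hpow0 (hitProb_nonneg h0 h1 k))
    (mul_nonneg (sub_nonneg.2 hpow1)
      (hitProb_nonneg (mul_nonneg h0 hpow0) (mul_le_one₀ h1 hpow0 hpow1) k))

lemma eigenFun_le (hb : 0 ≤ b) (h0 : 0 ≤ q) (h1 : q ≤ 1) (m k : ℕ) :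
    eigenFun b q m k ≤ ∑ i ∈ Finset.range m, eigenCoeff b q i :=
  Finset.sum_le_sum fun i _ => mul_le_of_le_one_right (eigenCoeff_nonneg hb h0 h1 i)
    (hitProb_le_one (pow_le_one₀ h0 h1) k)

lemma eigenFun_zero (b q : ℝ) (m : ℕ) : eigenFun b q m 0 = 0 := by
  simp [eigenFun, hitProb_zero]

lemma eigenFun_one_pos (hb : 0 ≤ b) (h0 : 0 < q) (h1 : q ≤ 1) {m : ℕ} (hm : m ≠ 0) :
    0 < eigenFun b q m 1 := by
  refine Finset.sum_pos' (fun i _ => mul_nonneg (eigenCoeff_nonneg hb h0.le h1 i)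
    (hitProb_nonneg (by positivity) (pow_le_one₀ h0.le h1) 1))
    ⟨0, Finset.mem_range.2 (Nat.pos_of_ne_zero hm), ?_⟩
  simpa [eigenCoeff_zero, hitProb_one] using h0

lemma exists_expanding_eigenFun (hb : 1 ≤ b) (h0 : 0 < q) (hbq : b * q < 1)
    (hsuper : 1 < localizationSum b q) :
    ∃ m ≠ 0, ∃ ε > 0, ∀ k, (1 + ε) * eigenFun b q m k ≤ b * meanEigenFun b q m k := by
  have hb0 : 0 ≤ b := by linarith
  have h1 : q ≤ 1 := by nlinarith
  obtain ⟨m, hm⟩ := ((summable_localizationTerm hb h0.le hbq).hasSum.tendsto_sum_nat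
    |>.eventually_const_lt hsuper).exists
  have hm0 : m ≠ 0 := by rintro rfl; norm_num at hm
  obtain ⟨c, hc⟩ : ∃ c, c = ∑ i ∈ Finset.range m, localizationTerm b q i - 1 := ⟨_, rfl⟩
  obtain ⟨C, hC⟩ : ∃ C, C = ∑ i ∈ Finset.range m, eigenCoeff b q i := ⟨_, rfl⟩
  have hc0 : 0 < c := by linarith
  have hC0 : 0 < C := hC ▸ Finset.sum_pos' (fun i _ => eigenCoeff_nonneg hb0 h0.le h1 i)
    ⟨0, Finset.mem_range.2 (Nat.pos_of_ne_zero hm0), by simp [eigenCoeff_zero]⟩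
  refine ⟨m, hm0, c * q / C, by positivity, fun k => ?_⟩
  have hgain : c * q / C * eigenFun b q m k ≤ c * hitProb q k := by
    rcases eq_or_ne k 0 with rfl | hk
    · simp [eigenFun_zero, hitProb_zero]
    calc c * q / C * eigenFun b q m k ≤ c * q / C * C := by
          gcongr
          exact (eigenFun_le hb0 h0.le h1 m k).trans_eq hC.symm
      _ = c * q := by field_simp
      _ ≤ c * hitProb q k := by gcongr; exact le_hitProb h0.le h1 hk
  have hlast : 0 ≤ eigenCoeff b q m * hitProb (q ^ (m + 1)) k :=
    mul_nonneg (eigenCoeff_nonneg hb0 h0.le h1 m)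
      (hitProb_nonneg (by positivity) (pow_le_one₀ h0.le h1) k)
  rw [mul_meanEigenFun, ← hc]
  linarith

end EigenFun

/-! ### The particles that only step away from the root -/

section Occupants

variable {S : Type*} [DecidableEq S]

/-- Given the set `A` of particles at a vertex at distance `n` from the root, those that jump in
direction `i` at time `n`. The particle `x` starts at time `x.length`, and `J (x, k)` is the
direction of its jump number `k`, or `none` if it dies instead. -/
def jumpers (J : List S × ℕ → Option S) (A : Finset (List S)) (i : S) (n : ℕ) :
    Finset (List S) :=
  A.filter fun x => J (x, n - x.length) = some i

/-- Given the set `A` of particles at the vertex `l`, those at its child `i :: l` one time step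
later: the particles that jump there, and the one that they activate. -/
def childOccupants (J : List S × ℕ → Option S) (A : Finset (List S)) (i : S) (l : List S) :
    Finset (List S) :=
  if (jumpers J A i l.length).Nonempty then insert (i :: l) (jumpers J A i l.length) else ∅

/-- The active particles at the vertex `v` at time `v.length`. A particle that reaches `v` at that
time has never stepped towards the root. -/
def occupants (J : List S × ℕ → Option S) : List S → Finset (List S)
  | [] => {[]}
  | i :: l => childOccupants J (occupants J l) i l

variable {J J' : List S × ℕ → Option S} {A : Finset (List S)} {i : S} {l v w x : List S} {n k : ℕ}

lemma mem_jumpers : x ∈ jumpers J A i n ↔ x ∈ A ∧ J (x, n - x.length) = some i :=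
  Finset.mem_filter

lemma mem_childOccupants : x ∈ childOccupants J A i l ↔
    x ∈ jumpers J A i l.length ∨ x = i :: l ∧ (jumpers J A i l.length).Nonempty := by
  unfold childOccupants
  split_ifs with h
  · simp [h, or_comm]
  · simp [Finset.not_nonempty_iff_eq_empty.1 h]

lemma childOccupants_nonempty_iff :
    (childOccupants J A i l).Nonempty ↔ (jumpers J A i l.length).Nonempty := by
  unfold childOccupants
  split_ifs with h <;> simp [h]

lemma mem_occupants_cons : x ∈ occupants J (i :: l) ↔
    x ∈ jumpers J (occupants J l) i l.length ∨ x = i :: l ∧ (occupants J (i :: l)).Nonempty := by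
  rw [occupants, childOccupants_nonempty_iff, mem_childOccupants]

lemma isSuffix_of_mem_occupants (h : x ∈ occupants J v) : x <:+ v := by
  induction v with
  | nil => simp_all [occupants]
  | cons i l ih =>
    rcases mem_occupants_cons.1 h with hjump | ⟨rfl, -⟩
    · exact (ih (mem_jumpers.1 hjump).1).trans (List.suffix_cons i l)
    · exact List.suffix_rfl

lemma length_le_of_mem_occupants (h : x ∈ occupants J v) : x.length ≤ v.length :=
  (isSuffix_of_mem_occupants h).length_le

lemma mem_occupants_cons_of_length_le (h : x.length ≤ l.length) :
    x ∈ occupants J (i :: l) ↔ x ∈ occupants J l ∧ J (x, l.length - x.length) = some i := by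
  rw [mem_occupants_cons, mem_jumpers, or_iff_left]
  rintro ⟨rfl, -⟩
  simp at h

lemma self_mem_occupants_iff : v ∈ occupants J v ↔ (occupants J v).Nonempty := by
  refine ⟨fun h => ⟨v, h⟩, fun h => ?_⟩
  cases v with
  | nil => simp [occupants]
  | cons i l => exact mem_occupants_cons.2 (Or.inr ⟨rfl, h⟩)

lemma occupants_nonempty_tail (h : (occupants J v).Nonempty) : (occupants J v.tail).Nonempty := by
  cases v with
  | nil => exact h
  | cons i l =>
    rw [occupants, childOccupants_nonempty_iff] at h
    exact h.imp fun x hx => (mem_jumpers.1 hx).1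

lemma eq_of_mem_occupants (hvw : v.length = w.length) (hv : x ∈ occupants J v)
    (hw : x ∈ occupants J w) : v = w := by
  induction v generalizing w with
  | nil => exact (List.length_eq_zero_iff.1 hvw.symm).symm
  | cons i l ih =>
    cases w with
    | nil => simp at hvw
    | cons i' l' =>
      have hxv := isSuffix_of_mem_occupants hv
      have hxw := isSuffix_of_mem_occupants hw
      rcases mem_occupants_cons.1 hv with hv | ⟨rfl, -⟩
      · rcases mem_occupants_cons.1 hw with hw | ⟨rfl, -⟩
        · rw [mem_jumpers] at hv hw
          obtain rfl := ih (by simpa using hvw) hv.1 hw.1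
          rw [Option.some.inj (hv.2.symm.trans hw.2)]
        · exact (hxv.eq_of_length hvw.symm).symm
      · exact hxw.eq_of_length hvw

lemma ne_none_of_mem_occupants (hx : x ∈ occupants J v) (hk : x.length + k < v.length) :
    J (x, k) ≠ none := by
  induction v with
  | nil => simp at hk
  | cons i l ih =>
    rw [List.length_cons] at hk
    rcases mem_occupants_cons.1 hx with hjump | ⟨rfl, -⟩
    · rw [mem_jumpers] at hjump
      rcases (by omega : x.length + k < l.length ∨ k = l.length - x.length) with hk' | rfl
      · exact ih hjump.1 hk'
      · simp [hjump.2]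
    · simp at hk
      omega

lemma childOccupants_congr (h : ∀ x ∈ A, J (x, l.length - x.length) = J' (x, l.length - x.length)) :
    childOccupants J A i l = childOccupants J' A i l := by
  have hjumpers : jumpers J A i l.length = jumpers J' A i l.length :=
    Finset.filter_congr fun x hx => by rw [h x hx]
  rw [childOccupants, childOccupants, hjumpers]

lemma occupants_congr (h : ∀ x, x <:+ v → ∀ k, x.length + k < v.length →
      (∀ j < k, J (x, j) ≠ none) → J (x, k) = J' (x, k)) :
    occupants J v = occupants J' v := by
  induction v with
  | nil => rfl
  | cons i l ih =>
    have hl : occupants J l = occupants J' l := ih fun x hx k hk =>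
      h x (hx.trans (List.suffix_cons i l)) k (hk.trans (by simp))
    rw [occupants, occupants, ← hl]
    refine childOccupants_congr fun x hx => ?_
    have hlen := length_le_of_mem_occupants hx
    exact h x ((isSuffix_of_mem_occupants hx).trans (List.suffix_cons i l)) _
      (by rw [List.length_cons]; omega) fun j hj => ne_none_of_mem_occupants hx (by omega)

end Occupants

section Level

variable {S : Type*} [DecidableEq S] [Fintype S]

/-- The directions leading from the vertex `l` away from the root. -/
def awayDirections (l : List S) : Finset S :=
  Finset.univ.filter fun i => l.head? ≠ some i

lemma card_awayDirections_nil :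
    (awayDirections ([] : List S)).card = Fintype.card S := by
  simp [awayDirections]

lemma card_awayDirections_cons (a : S) (l : List S) :
    (awayDirections (a :: l)).card = Fintype.card S - 1 := by
  have herase : awayDirections (a :: l) = Finset.univ.erase a := by
    ext i
    simp [awayDirections, eq_comm]
  rw [herase, Finset.card_erase_of_mem (Finset.mem_univ a), Finset.card_univ]

lemma card_sub_one_le_card_awayDirections (l : List S) :
    Fintype.card S - 1 ≤ (awayDirections l).card := by
  cases l with
  | nil => rw [card_awayDirections_nil]; exact Nat.sub_le _ _
  | cons a l => rw [card_awayDirections_cons]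

/-- The vertices at distance `n` from the root. -/
def level (S : Type*) [DecidableEq S] [Fintype S] : ℕ → Finset (List S)
  | 0 => {[]}
  | n + 1 => (level S n).biUnion fun l => (awayDirections l).image (· :: l)

lemma mem_level {n : ℕ} {v : List S} :
    v ∈ level S n ↔ v.length = n ∧ v.IsChain (fun a b => a ≠ b) := by
  induction n generalizing v with
  | zero => simp +contextual [level, List.length_eq_zero_iff]
  | succ n ih =>
    simp only [level, Finset.mem_biUnion, Finset.mem_image]
    cases v with
    | nil => simp
    | cons i l =>
      have haway : i ∈ awayDirections l ↔ ∀ a ∈ l.head?, i ≠ a := by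
        simp only [awayDirections, Finset.mem_filter, Finset.mem_univ, true_and]
        exact ⟨fun h a ha hia => h (hia ▸ ha), fun h hi => h i hi rfl⟩
      rw [List.isChain_cons, ← haway, List.length_cons, add_left_inj, and_left_comm, ← ih]
      simp [and_comm]

@[to_additive]
lemma prod_level_succ {M : Type*} [CommMonoid M] (n : ℕ) (f : List S → M) :
    ∏ v ∈ level S (n + 1), f v = ∏ l ∈ level S n, ∏ i ∈ awayDirections l, f (i :: l) := by
  rw [level, Finset.prod_biUnion]
  · exact Finset.prod_congr rfl fun l _ => Finset.prod_image (by simp)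
  · refine fun l _ l' _ hll => Finset.disjoint_left.2 fun v hv hv' => hll ?_
    obtain ⟨i, -, rfl⟩ := Finset.mem_image.1 hv
    obtain ⟨i', -, h⟩ := Finset.mem_image.1 hv'
    exact (List.cons.inj h).2.symm

lemma card_level_succ (n : ℕ) :
    (level S (n + 1)).card = Fintype.card S * (Fintype.card S - 1) ^ n := by
  induction n with
  | zero =>
    rw [Finset.card_eq_sum_ones, sum_level_succ]
    simp [level, card_awayDirections_nil]
  | succ n ih =>
    have hcard : ∀ l ∈ level S (n + 1), (awayDirections l).card = Fintype.card S - 1 := by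
      rintro (_ | ⟨a, l⟩) hl
      · simp [mem_level] at hl
      · exact card_awayDirections_cons a l
    rw [Finset.card_eq_sum_ones, sum_level_succ]
    simp only [← Finset.card_eq_sum_ones]
    rw [Finset.sum_congr rfl hcard, Finset.sum_const, ih, smul_eq_mul, pow_succ, mul_assoc]

end Level

section Dynamics

variable {d : ℕ}

open Classical in
/-- The direction of the jump number `k` of the particle `x`, or `none` from the end of its lifetime
on. The value at words that are not vertices is irrelevant. -/
noncomputable def jumpOf (ω : Outcome d) (a : List (Fin (d + 1)) × ℕ) : Option (Fin (d + 1)) :=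
  if h : a.1.IsChain (fun a b => a ≠ b) then
    if a.2 < lifetime ω ⟨a.1, h⟩ then some ((ω ⟨a.1, h⟩).2 a.2) else none
  else none

lemma jumpOf_eq_some_iff {ω : Outcome d} {x : Vertex d} {k : ℕ} {i : Fin (d + 1)} :
    jumpOf ω (x.1, k) = some i ↔ k < lifetime ω x ∧ (ω x).2 k = i := by
  simp [jumpOf, x.2]

lemma neighbor_eq_cons {i : Fin (d + 1)} {l : List (Fin (d + 1))}
    (h : (i :: l).IsChain (fun a b => a ≠ b)) : neighbor ⟨l, h.tail⟩ i = ⟨i :: l, h⟩ := by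
  refine Subtype.ext ?_
  rw [neighbor_val, if_neg]
  exact fun hi => (List.isChain_cons.1 h).1 i hi rfl

lemma walk_eq_of_mem_occupants {ω : Outcome d} {x v : Vertex d} {n : ℕ}
    (hx : x.1 ∈ occupants (jumpOf ω) v.1) (hn : x.1.length + n = v.1.length) :
    walk ω x n = v := by
  obtain ⟨v, hv⟩ := v
  induction v generalizing n with
  | nil =>
    obtain ⟨hx0, rfl⟩ := Nat.add_eq_zero_iff.1 hn
    exact Subtype.ext (List.length_eq_zero_iff.1 hx0)
  | cons i l ih =>
    rcases n with - | k
    · exact Subtype.ext ((isSuffix_of_mem_occupants hx).eq_of_length hn)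
    · have hk : x.1.length + k = l.length := by simpa [← add_assoc] using hn
      obtain ⟨hxl, hjump⟩ := (mem_occupants_cons_of_length_le (by omega)).1 hx
      rw [← hk, Nat.add_sub_cancel_left] at hjump
      rw [walk, ih hv.tail hxl hk, (jumpOf_eq_some_iff.1 hjump).2, neighbor_eq_cons]

/-- The state of the system at time `t` in terms of the particles that only step away from the root:
every active particle has done so, since a step towards the root leads to a visited vertex. -/
def occupancyState (ω : Outcome d) (t : ℕ) : State d where
  visited := {v | v.1.length ≤ t ∧ (occupants (jumpOf ω) v.1).Nonempty}
  active := {a | a.1.1.length + a.2 = t ∧ (walk ω a.1 a.2).1.length = t ∧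
    a.1.1 ∈ occupants (jumpOf ω) (walk ω a.1 a.2).1}

variable {ω : Outcome d} {t n : ℕ} {x y v : Vertex d}

lemma mem_active_of_mem_occupants (hx : x.1 ∈ occupants (jumpOf ω) v.1)
    (hn : x.1.length + n = v.1.length) : (x, n) ∈ (occupancyState ω v.1.length).active := by
  simp only [occupancyState, Set.mem_ofPred_eq, walk_eq_of_mem_occupants hx hn]
  exact ⟨hn, trivial, hx⟩

lemma notMem_visited_of_lt (hv : t < v.1.length) : v ∉ (occupancyState ω t).visited :=
  fun h => hv.not_ge h.1

lemma walk_succ_val_of_notMem_visited (hx : (x, n) ∈ (occupancyState ω t).active)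
    (hnew : walk ω x (n + 1) ∉ (occupancyState ω t).visited) :
    (walk ω x (n + 1)).1 = (ω x).2 n :: (walk ω x n).1 := by
  obtain ⟨-, hlen, hocc⟩ := hx
  rw [walk, neighbor_val]
  refine if_neg fun hback => hnew ⟨?_, ?_⟩ <;> rw [walk, neighbor_val, if_pos hback]
  · rw [List.length_tail]
    exact (Nat.sub_le _ _).trans hlen.le
  · exact occupants_nonempty_tail ⟨_, hocc⟩

lemma succ_mem_active_iff : (x, n + 1) ∈ (occupancyState ω (t + 1)).active ↔
    (x, n) ∈ (occupancyState ω t).active ∧ n < lifetime ω x ∧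
      walk ω x (n + 1) ∉ (occupancyState ω t).visited := by
  constructor
  · rintro ⟨htime, hlen, hocc⟩
    have hnew := notMem_visited_of_lt (ω := ω) (t.lt_succ_self.trans_eq hlen.symm)
    refine and_assoc.1 ⟨?_, hnew⟩
    dsimp only at htime hlen hocc
    generalize walk ω x (n + 1) = y at hlen hocc
    obtain ⟨_ | ⟨i, l⟩, hy⟩ := y
    · simp at hlen
    obtain rfl : l.length = t := by simpa using hlen
    have hn : x.1.length + n = l.length := by omega
    obtain ⟨hxl, hjump⟩ := (mem_occupants_cons_of_length_le (by omega)).1 hocc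
    rw [← hn, Nat.add_sub_cancel_left] at hjump
    exact ⟨mem_active_of_mem_occupants (v := ⟨l, hy.tail⟩) hxl hn, (jumpOf_eq_some_iff.1 hjump).1⟩
  · rintro ⟨hx, hlife, hnew⟩
    have hval := walk_succ_val_of_notMem_visited hx hnew
    obtain ⟨htime, hlen, hocc⟩ := hx
    have hn : (walk ω x n).1.length - x.1.length = n := by simp only at htime hlen; omega
    refine ⟨by simpa [← add_assoc] using htime, by simpa [hval] using hlen, ?_⟩
    simp only [hval, mem_occupants_cons, mem_jumpers, hn]
    exact Or.inl ⟨hocc, jumpOf_eq_some_iff.2 ⟨hlife, rfl⟩⟩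

lemma zero_mem_active_iff : (x, 0) ∈ (occupancyState ω t).active ↔
    x.1.length = t ∧ (occupants (jumpOf ω) x.1).Nonempty := by
  simp [occupancyState, walk, self_mem_occupants_iff]

lemma mem_jumpTargets_iff (hy : y ∉ (occupancyState ω t).visited) :
    y ∈ jumpTargets ω (occupancyState ω t) ↔
      y.1.length = t + 1 ∧ (occupants (jumpOf ω) y.1).Nonempty := by
  constructor
  · rintro ⟨x, n, hx, hlife, rfl⟩
    obtain ⟨-, hlen, hocc⟩ := succ_mem_active_iff.2 ⟨hx, hlife, hy⟩
    exact ⟨hlen, _, hocc⟩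
  · rintro ⟨hlen, hne⟩
    obtain ⟨_ | ⟨i, l⟩, hchain⟩ := y
    · simp at hlen
    obtain rfl : l.length = t := by simpa using hlen
    rw [occupants, childOccupants_nonempty_iff] at hne
    obtain ⟨x, hjump⟩ := hne
    obtain ⟨hxl, hjump⟩ := mem_jumpers.1 hjump
    have hsuffix := isSuffix_of_mem_occupants hxl
    have hn : x.length + (l.length - x.length) = l.length :=
      Nat.add_sub_cancel' hsuffix.length_le
    let x' : Vertex d := ⟨x, hchain.tail.suffix hsuffix⟩
    obtain ⟨hlife, hdir⟩ := jumpOf_eq_some_iff (x := x').1 hjump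
    refine ⟨x', l.length - x.length,
      mem_active_of_mem_occupants (v := ⟨l, hchain.tail⟩) hxl hn, hlife, ?_⟩
    rw [walk, walk_eq_of_mem_occupants (v := ⟨l, hchain.tail⟩) hxl hn, hdir, neighbor_eq_cons]

lemma step_occupancyState (ω : Outcome d) (t : ℕ) :
    step ω (occupancyState ω t) = occupancyState ω (t + 1) := by
  suffices h : (step ω (occupancyState ω t)).visited = (occupancyState ω (t + 1)).visited ∧
      (step ω (occupancyState ω t)).active = (occupancyState ω (t + 1)).active from
    State.mk.injEq .. |>.mpr h
  constructor
  · ext v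
    by_cases hv : v ∈ (occupancyState ω t).visited
    · exact iff_of_true (Or.inl hv) ⟨hv.1.trans t.le_succ, hv.2⟩
    · rw [step, Set.mem_union, or_iff_right hv, mem_jumpTargets_iff hv]
      refine and_congr_left fun hne => ⟨fun h => h.le, fun h => ?_⟩
      exact h.antisymm (not_le.1 fun hle => hv ⟨hle, hne⟩)
  · ext ⟨x, n⟩
    cases n with
    | zero =>
      rw [zero_mem_active_iff]
      simp only [step, Set.mem_union, Set.mem_ofPred_eq, Prod.mk.injEq]
      constructor
      · rintro (⟨x', n', -, -, -, -, h⟩ | ⟨y, hy, hnew, rfl, -⟩)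
        · exact absurd h (by omega)
        · exact (mem_jumpTargets_iff hnew).1 hy
      · rintro ⟨hlen, hne⟩
        have hnew := notMem_visited_of_lt (ω := ω) (t.lt_succ_self.trans_eq hlen.symm)
        exact Or.inr ⟨x, (mem_jumpTargets_iff hnew).2 ⟨hlen, hne⟩, hnew, rfl, trivial⟩
    | succ n =>
      rw [succ_mem_active_iff]
      simp only [step, Set.mem_union, Set.mem_ofPred_eq, Prod.mk.injEq]
      constructor
      · rintro (⟨x, n, hx, hlife, hnew, rfl, h⟩ | ⟨y, -, -, -, h⟩)
        · obtain rfl := Nat.succ.inj h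
          exact ⟨hx, hlife, hnew⟩
        · exact absurd h (by omega)
      · rintro ⟨hx, hlife, hnew⟩
        exact Or.inl ⟨x, n, hx, hlife, hnew, rfl, rfl⟩

lemma stateAt_eq_occupancyState (ω : Outcome d) (t : ℕ) : stateAt ω t = occupancyState ω t := by
  induction t with
  | zero =>
    rw [stateAt, initialState, occupancyState, State.mk.injEq]
    constructor
    · ext v
      have hroot : v = root d ↔ v.1 = [] := Subtype.ext_iff
      simp only [Set.mem_singleton_iff, Set.mem_ofPred_eq, Nat.le_zero, List.length_eq_zero_iff,
        hroot]
      exact ⟨fun h => ⟨h, by simp [h, occupants]⟩, And.left⟩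
    · ext ⟨x, n⟩
      have hroot : x = root d ↔ x.1 = [] := Subtype.ext_iff
      simp only [Set.mem_singleton_iff, Set.mem_ofPred_eq, Prod.mk.injEq, Nat.add_eq_zero_iff,
        List.length_eq_zero_iff, hroot]
      refine ⟨?_, And.left⟩
      rintro ⟨hx, rfl⟩
      simp [walk, hx, occupants]
  | succ t ih => rw [stateAt, ih, step_occupancyState]

lemma mem_survival_iff :
    ω ∈ survival d ↔ ∀ t, ∃ v ∈ level (Fin (d + 1)) t, (occupants (jumpOf ω) v).Nonempty := by
  refine forall_congr' fun t => ?_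
  rw [stateAt_eq_occupancyState]
  constructor
  · rintro ⟨⟨x, n⟩, -, hlen, hocc⟩
    exact ⟨_, mem_level.2 ⟨hlen, (walk ω x n).2⟩, _, hocc⟩
  · rintro ⟨v, hv, hne⟩
    obtain ⟨hlen, hchain⟩ := mem_level.1 hv
    exact ⟨(⟨v, hchain⟩, 0), zero_mem_active_iff.2 ⟨hlen, hne⟩⟩

end Dynamics

/-! ### Functions of finitely many independent coordinates -/

section ProductMeasure

variable {I V α : Type*} {P L : Finset I}

lemma exists_eq_comp_restrict_of_dependsOn [Nonempty α] {G : (I → α) → (I → α) → ℝ}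
    (hP : ∀ η, DependsOn (fun ξ => G ξ η) (P : Set I)) (hL : ∀ ξ, DependsOn (G ξ) (L : Set I)) :
    ∃ g : (P → α) → (L → α) → ℝ, ∀ ξ η, G ξ η = g (P.restrict ξ) (L.restrict η) := by
  classical
  let extend (Q : Finset I) (a : Q → α) (i : I) : α :=
    if h : i ∈ Q then a ⟨i, h⟩ else Classical.arbitrary α
  have hextend : ∀ (Q : Finset I) (ξ : I → α), ∀ i ∈ (Q : Set I), ξ i = extend Q (Q.restrict ξ) i :=
    fun Q ξ i hi => by simp [extend, Finset.mem_coe.1 hi]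
  exact ⟨fun a b => G (extend P a) (extend L b),
    fun ξ η => (hP η (hextend P ξ)).trans (hL _ (hextend L η))⟩

variable [Finite α] [MeasurableSpace α] [MeasurableSingletonClass α]

lemma measurable_of_dependsOn {β : Type*} [MeasurableSpace β] [Nonempty β] {f : (I → α) → β}
    (hf : DependsOn f (P : Set I)) : Measurable f := by
  obtain ⟨g, rfl⟩ := dependsOn_iff_exists_comp.1 hf
  exact (measurable_of_finite g).comp (measurable_pi_lambda _ fun i => measurable_pi_apply i.1)

variable {κ : Measure α} [IsProbabilityMeasure κ]

lemma integrable_of_dependsOn {f : (I → α) → ℝ} (hf : DependsOn f (P : Set I)) :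
    Integrable f (Measure.infinitePi fun _ : I => κ) := by
  have hmeas := measurable_of_dependsOn hf
  obtain ⟨g, rfl⟩ := dependsOn_iff_exists_comp.1 hf
  obtain ⟨C, hC⟩ := (Set.finite_range fun a => ‖g a‖).bddAbove
  exact Integrable.of_bound hmeas.aestronglyMeasurable C
    (Filter.Eventually.of_forall fun ξ => hC ⟨_, rfl⟩)

lemma integral_diag_of_dependsOn (hPL : Disjoint P L) {G : (I → α) → (I → α) → ℝ}
    (hP : ∀ η, DependsOn (fun ξ => G ξ η) (P : Set I)) (hL : ∀ ξ, DependsOn (G ξ) (L : Set I)) :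
    ∫ ξ, G ξ ξ ∂(Measure.infinitePi fun _ : I => κ) =
      ∫ ξ, ∫ η, G ξ η ∂(Measure.infinitePi fun _ : I => κ)
        ∂(Measure.infinitePi fun _ : I => κ) := by
  have := nonempty_of_isProbabilityMeasure κ
  obtain ⟨g, hg⟩ := exists_eq_comp_restrict_of_dependsOn hP hL
  set ρ := Measure.infinitePi fun _ : I => κ
  have hindep : IndepFun P.restrict L.restrict ρ :=
    (iIndepFun_infinitePi (P := fun _ : I => κ) (X := fun _ x => x)
      fun _ => measurable_id).indepFun_finset P L hPL fun i => measurable_pi_apply i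
  have hPm : Measurable (P.restrict : (I → α) → (P → α)) := Finset.measurable_restrict P
  have hLm : Measurable (L.restrict : (I → α) → (L → α)) := Finset.measurable_restrict L
  have := Measure.isProbabilityMeasure_map (μ := ρ) hPm.aemeasurable
  have := Measure.isProbabilityMeasure_map (μ := ρ) hLm.aemeasurable
  simp only [hg]
  calc ∫ ξ, g (P.restrict ξ) (L.restrict ξ) ∂ρ
      = ∫ z, g z.1 z.2 ∂(ρ.map fun ξ => (P.restrict ξ, L.restrict ξ)) := by
        rw [integral_map (hPm.prodMk hLm).aemeasurable
          (measurable_of_finite _).aestronglyMeasurable]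
    _ = ∫ a, ∫ b, g a b ∂(ρ.map L.restrict) ∂(ρ.map P.restrict) := by
        rw [(indepFun_iff_map_prod_eq_prod_map_map hPm.aemeasurable hLm.aemeasurable).1 hindep,
          integral_prod _ Integrable.of_finite]
    _ = ∫ ξ, ∫ b, g (P.restrict ξ) b ∂(ρ.map L.restrict) ∂ρ :=
        integral_map hPm.aemeasurable (measurable_of_finite _).aestronglyMeasurable
    _ = ∫ ξ, ∫ η, g (P.restrict ξ) (L.restrict η) ∂ρ ∂ρ := by
        simp only [integral_map hLm.aemeasurable (measurable_of_finite _).aestronglyMeasurable]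

lemma integral_prod_of_dependsOn {s : Finset V} {A : V → Finset I}
    (hA : (s : Set V).PairwiseDisjoint A) {f : V → (I → α) → ℝ}
    (hf : ∀ v ∈ s, DependsOn (f v) (A v : Set I)) :
    ∫ ξ, ∏ v ∈ s, f v ξ ∂(Measure.infinitePi fun _ : I => κ) =
      ∏ v ∈ s, ∫ ξ, f v ξ ∂(Measure.infinitePi fun _ : I => κ) := by
  classical
  induction s using Finset.induction_on with
  | empty => simp
  | insert w s hw ih =>
    have hdisj : Disjoint (A w) (s.biUnion A) := by
      rw [Finset.disjoint_biUnion_right]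
      exact fun v hv => hA (by simp) (by simp [hv]) (by rintro rfl; exact hw hv)
    have htail : DependsOn (fun η => ∏ v ∈ s, f v η) (s.biUnion A : Set I) := fun η η' h =>
      Finset.prod_congr rfl fun v hv => hf v (Finset.mem_insert_of_mem hv) fun i hi =>
        h i (Finset.mem_coe.2 (Finset.mem_biUnion.2 ⟨v, hv, hi⟩))
    simp only [Finset.prod_insert hw]
    rw [integral_diag_of_dependsOn (G := fun ξ η => f w ξ * ∏ v ∈ s, f v η) hdisj
      (fun η _ _ h => congrArg (· * ∏ v ∈ s, f v η) (hf w (by simp) h))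
      (fun ξ _ _ h => congrArg (f w ξ * ·) (htail h))]
    simp only [integral_const_mul, integral_mul_const]
    rw [ih (hA.subset (by simp)) fun v hv => hf v (by simp [hv])]

end ProductMeasure

/-! ### Occupation under independent jumps -/

section JumpField

section Indices

variable {S : Type*} [Finite S] {n : ℕ} {A : Finset (List S)} {l v : List S}

variable (S) in
/-- The pairs `(x, k)` such that the jump number `k` of the particle `x` takes place before
time `n`. -/
noncomputable def jumpsBefore (n : ℕ) : Finset (List S × ℕ) :=
  ((List.finite_length_le S n).toFinset ×ˢ Finset.range n).filter fun a => a.1.length + a.2 < n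

lemma mem_jumpsBefore {a : List S × ℕ} : a ∈ jumpsBefore S n ↔ a.1.length + a.2 < n := by
  simp only [jumpsBefore, Finset.mem_filter, Finset.mem_product, Set.Finite.mem_toFinset,
    Set.mem_ofPred_eq, Finset.mem_range, and_iff_right_iff_imp]
  omega

variable [DecidableEq S]

/-- The jumps of the particles in `A` that take place at time `n`. -/
def jumpsAt (A : Finset (List S)) (n : ℕ) : Finset (List S × ℕ) :=
  A.image fun x => (x, n - x.length)

lemma jumpsAt_subset (hA : ∀ x ∈ A, x.length ≤ n) :
    jumpsAt A n ⊆ jumpsBefore S (n + 1) \ jumpsBefore S n := by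
  refine Finset.image_subset_iff.2 fun x hx => ?_
  have hlen := hA x hx
  simp only [Finset.mem_sdiff, mem_jumpsBefore]
  omega

lemma occupants_eq_of_eqOn {ξ ξ' : List S × ℕ → Option S}
    (h : ∀ a ∈ (jumpsBefore S v.length : Set (List S × ℕ)), ξ a = ξ' a) :
    occupants ξ v = occupants ξ' v :=
  occupants_congr fun x _ k hk _ => h (x, k) (Finset.mem_coe.2 (mem_jumpsBefore.2 hk))

omit [Finite S] in
lemma childOccupants_eq_of_eqOn {ξ ξ' : List S × ℕ → Option S} {i : S}
    (h : ∀ a ∈ (jumpsAt A l.length : Set (List S × ℕ)), ξ a = ξ' a) :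
    childOccupants ξ A i l = childOccupants ξ' A i l :=
  childOccupants_congr fun _ hx => h _ (Finset.mem_coe.2 (Finset.mem_image_of_mem _ hx))

end Indices

lemma hitProb_card_childOccupants {S : Type*} [DecidableEq S] {J : List S × ℕ → Option S}
    {A : Finset (List S)} {l : List S} (hA : ∀ x ∈ A, x.length ≤ l.length) (i : S) (u : ℝ) :
    hitProb u (childOccupants J A i l).card = 1 - (1 - u) * (1 - u) ^ (jumpers J A i l.length).card
      - u * 0 ^ (jumpers J A i l.length).card := by
  unfold childOccupants
  split_ifs with h
  · have hnew : i :: l ∉ jumpers J A i l.length := fun hmem =>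
      (hA _ (mem_jumpers.1 hmem).1).not_gt l.length.lt_succ_self
    rw [Finset.card_insert_of_notMem hnew, hitProb, zero_pow h.card_pos.ne']
    ring
  · simp [Finset.not_nonempty_iff_eq_empty.1 h, hitProb]

variable {S : Type*} [DecidableEq S] [Finite S] [MeasurableSpace (Option S)]
  [MeasurableSingletonClass (Option S)] {κ : Measure (Option S)} [IsProbabilityMeasure κ] {q : ℝ}
  {A : Finset (List S)} {l v : List S}

/-- The law of a field of independent jumps with law `κ`; the direction `i` has probability
`κ.real {some i}`, and the particle dies with probability `κ.real {none}`. -/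
noncomputable abbrev jumpFieldLaw (κ : Measure (Option S)) [IsProbabilityMeasure κ] :
    Measure (List S × ℕ → Option S) :=
  Measure.infinitePi fun _ => κ

lemma integrable_comp_occupants (f : Finset (List S) → ℝ) (v : List S) :
    Integrable (fun ξ => f (occupants ξ v)) (jumpFieldLaw κ) :=
  integrable_of_dependsOn (P := jumpsBefore S v.length) fun _ _ h =>
    congrArg f (occupants_eq_of_eqOn h)

lemma measurableSet_occupants_nonempty (v : List S) :
    MeasurableSet {ξ : List S × ℕ → Option S | (occupants ξ v).Nonempty} :=
  measurableSet_setOfPred.2 <| measurable_of_dependsOn (P := jumpsBefore S v.length) fun _ _ h => by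
    rw [occupants_eq_of_eqOn h]

lemma integrable_comp_childOccupants (f : Finset (List S) → ℝ) (A : Finset (List S)) (i : S)
    (l : List S) : Integrable (fun ξ => f (childOccupants ξ A i l)) (jumpFieldLaw κ) :=
  integrable_of_dependsOn (P := jumpsAt A l.length) fun _ _ h =>
    congrArg f (childOccupants_eq_of_eqOn h)

variable (hκ : ∀ i, κ.real {some i} = q)
include hκ

lemma integral_ite_jump_eq (i : S) (s : ℝ) (a : List S × ℕ) :
    ∫ ξ, (if ξ a = some i then s else 1) ∂(jumpFieldLaw κ) = 1 - q + q * s := by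
  have heval := measurePreserving_eval_infinitePi (fun _ : List S × ℕ => κ) a
  have hsingle : MeasurableSet {(some i : Option S)} := measurableSet_singleton _
  calc ∫ ξ, (if ξ a = some i then s else 1) ∂(jumpFieldLaw κ)
      = ∫ b, (if b = some i then s else 1) ∂κ := by
        have hmap := integral_map (μ := jumpFieldLaw κ) heval.measurable.aemeasurable
          (f := fun b : Option S => if b = some i then s else 1)
          (measurable_of_finite _).aestronglyMeasurable
        rw [heval.map_eq] at hmap
        exact hmap.symm
    _ = ∫ b, 1 + Set.indicator {some i} (fun _ => s - 1) b ∂κ := by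
        refine integral_congr_ae (Filter.Eventually.of_forall fun b => ?_)
        by_cases hb : b = some i <;> simp [hb]
    _ = 1 - q + q * s := by
        rw [integral_add (integrable_const _) ((integrable_const _).indicator hsingle),
          integral_indicator_const _ hsingle, hκ]
        simp
        ring

lemma integral_pow_card_jumpers (A : Finset (List S)) (i : S) (n : ℕ) (s : ℝ) :
    ∫ ξ, s ^ (jumpers ξ A i n).card ∂(jumpFieldLaw κ) = (1 - q + q * s) ^ A.card := by
  have hprod : ∀ ξ : List S × ℕ → Option S, s ^ (jumpers ξ A i n).card =
      ∏ x ∈ A, if ξ (x, n - x.length) = some i then s else 1 := fun ξ => by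
    rw [Finset.prod_ite, Finset.prod_const, Finset.prod_const_one, mul_one, jumpers]
  simp only [hprod]
  rw [integral_prod_of_dependsOn (A := fun x => {(x, n - x.length)})]
  · simp only [integral_ite_jump_eq hκ, Finset.prod_const]
  · intro x _ y _ hxy
    simp only [Function.onFun, Finset.disjoint_singleton]
    exact fun h => hxy (congrArg Prod.fst h)
  · intro x _ ξ ξ' h
    simp only [h (x, n - x.length) (by simp)]

lemma integral_hitProb_card_childOccupants (hA : ∀ x ∈ A, x.length ≤ l.length) (i : S) (u : ℝ) :
    ∫ ξ, hitProb u (childOccupants ξ A i l).card ∂(jumpFieldLaw κ)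
      = u * hitProb q A.card + (1 - u) * hitProb (q * u) A.card := by
  have hint : ∀ s : ℝ, Integrable (fun ξ => s ^ (jumpers ξ A i l.length).card)
      (jumpFieldLaw κ) := fun s =>
    integrable_of_dependsOn (P := jumpsAt A l.length) fun ξ ξ' h =>
      congrArg (fun B : Finset (List S) => s ^ B.card) <| Finset.filter_congr fun x hx => by
        rw [h _ (Finset.mem_coe.2 (Finset.mem_image_of_mem _ hx))]
  simp only [hitProb_card_childOccupants hA]
  rw [integral_sub (by fun_prop) (by fun_prop), integral_sub (by fun_prop) (by fun_prop),
    integral_const_mul, integral_const_mul, integral_pow_card_jumpers hκ,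
    integral_pow_card_jumpers hκ]
  simp only [integral_const, probReal_univ, smul_eq_mul, hitProb]
  ring

lemma integral_hitProb_card_occupants (v : List S) (u : ℝ) :
    ∫ ξ, hitProb u (occupants ξ v).card ∂(jumpFieldLaw κ) = meanHit q v.length u := by
  induction v generalizing u with
  | nil => simp [occupants, hitProb_one, meanHit]
  | cons i l ih =>
    have hlen : ∀ (ξ : List S × ℕ → Option S), ∀ x ∈ occupants ξ l, x.length ≤ l.length :=
      fun _ _ => length_le_of_mem_occupants
    have hint : ∀ u, Integrable (fun ξ => hitProb u (occupants ξ l).card) (jumpFieldLaw κ) :=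
      fun u => integrable_comp_occupants (fun A => hitProb u A.card) l
    calc ∫ ξ, hitProb u (occupants ξ (i :: l)).card ∂(jumpFieldLaw κ)
        = ∫ ξ, ∫ η, hitProb u (childOccupants η (occupants ξ l) i l).card
            ∂(jumpFieldLaw κ) ∂(jumpFieldLaw κ) :=
          integral_diag_of_dependsOn
            (P := jumpsBefore S l.length)
            (L := jumpsBefore S (l.length + 1) \ jumpsBefore S l.length)
            (G := fun ξ η => hitProb u (childOccupants η (occupants ξ l) i l).card)
            Finset.disjoint_sdiff
            (fun η ξ ξ' h => by simp only [occupants_eq_of_eqOn h])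
            (fun ξ η η' h => by simp only [childOccupants_eq_of_eqOn fun a ha =>
              h a (Finset.coe_subset.2 (jumpsAt_subset (hlen ξ)) ha)])
      _ = ∫ ξ, (u * hitProb q (occupants ξ l).card + (1 - u) * hitProb (q * u)
            (occupants ξ l).card) ∂(jumpFieldLaw κ) := by
          simp only [integral_hitProb_card_childOccupants hκ (hlen _)]
      _ = meanHit q (l.length + 1) u := by
          rw [integral_add ((hint _).const_mul _) ((hint _).const_mul _), integral_const_mul,
            integral_const_mul, ih, ih, meanHit]

lemma measureReal_occupants_nonempty (v : List S) :
    (jumpFieldLaw κ).real {ξ | (occupants ξ v).Nonempty} = meanHit q v.length 1 := by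
  rw [← integral_hitProb_card_occupants hκ, ← integral_indicator_one
    (measurableSet_occupants_nonempty v)]
  refine integral_congr_ae (.of_forall fun ξ => ?_)
  by_cases h : (occupants ξ v).Nonempty
  · simp [h, hitProb, h.card_pos.ne']
  · simp [Finset.not_nonempty_iff_eq_empty.1 h, hitProb]

lemma integral_eigenFun_card_childOccupants (b : ℝ) (m : ℕ)
    (hA : ∀ x ∈ A, x.length ≤ l.length) (i : S) :
    ∫ ξ, eigenFun b q m (childOccupants ξ A i l).card ∂(jumpFieldLaw κ)
      = meanEigenFun b q m A.card := by
  simp only [eigenFun, meanEigenFun]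
  rw [integral_finsetSum _ fun k _ => integrable_comp_childOccupants
    (fun B => eigenCoeff b q k * hitProb (q ^ (k + 1)) B.card) A i l]
  simp only [integral_const_mul, integral_hitProb_card_childOccupants hκ hA]

end JumpField

/-! ### The two phases -/

section Phases

lemma prod_one_sub_le {ι : Type*} {s : Finset ι} {x : ι → ℝ} {δ : ℝ} (h0 : ∀ i ∈ s, 0 ≤ x i)
    (hsum : ∑ i ∈ s, x i ≤ δ) (hδ : δ ≤ 1) :
    ∏ i ∈ s, (1 - x i) ≤ 1 - (1 - δ) * ∑ i ∈ s, x i := by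
  have hle : ∀ i ∈ s, x i ≤ 1 := fun i hi => (Finset.single_le_sum h0 hi).trans (hsum.trans hδ)
  have hnonneg : 0 ≤ ∑ i ∈ s, x i := Finset.sum_nonneg h0
  have hexp := Real.abs_exp_sub_one_sub_id_le (x := -∑ i ∈ s, x i)
    (by rw [abs_neg, abs_of_nonneg hnonneg]; exact hsum.trans hδ)
  calc ∏ i ∈ s, (1 - x i) ≤ ∏ i ∈ s, Real.exp (-x i) :=
        Finset.prod_le_prod (fun i hi => sub_nonneg.2 (hle i hi)) fun i _ =>
          Real.one_sub_le_exp_neg _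
    _ = Real.exp (-∑ i ∈ s, x i) := by rw [← Real.exp_sum, Finset.sum_neg_distrib]
    _ ≤ 1 - ∑ i ∈ s, x i + (∑ i ∈ s, x i) ^ 2 := by
        linarith [(abs_le.1 hexp).2, neg_sq (∑ i ∈ s, x i)]
    _ ≤ 1 - (1 - δ) * ∑ i ∈ s, x i := by nlinarith

lemma integral_prod_one_sub_le {Ω ι : Type*} [MeasurableSpace Ω] {μ : Measure Ω}
    [IsProbabilityMeasure μ] {s : Finset ι} {F : ι → Ω → ℝ} {δ : ℝ}
    (h0 : ∀ i ∈ s, ∀ ω, 0 ≤ F i ω) (hsum : ∀ ω, ∑ i ∈ s, F i ω ≤ δ) (hδ : δ ≤ 1)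
    (hint : ∀ i ∈ s, Integrable (F i) μ) :
    ∫ ω, ∏ i ∈ s, (1 - F i ω) ∂μ ≤ 1 - (1 - δ) * ∑ i ∈ s, ∫ ω, F i ω ∂μ := by
  have hle : ∀ i ∈ s, ∀ ω, F i ω ≤ 1 := fun i hi ω =>
    (Finset.single_le_sum (fun j hj => h0 j hj ω) hi).trans ((hsum ω).trans hδ)
  have hsumint : Integrable (fun ω => (1 - δ) * ∑ i ∈ s, F i ω) μ :=
    (integrable_finsetSum s hint).const_mul _
  calc ∫ ω, ∏ i ∈ s, (1 - F i ω) ∂μ ≤ ∫ ω, 1 - (1 - δ) * ∑ i ∈ s, F i ω ∂μ :=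
        integral_mono_of_nonneg
          (.of_forall fun ω => Finset.prod_nonneg fun i hi => sub_nonneg.2 (hle i hi ω))
          ((integrable_const _).sub hsumint)
          (.of_forall fun ω => prod_one_sub_le (fun i hi => h0 i hi ω) (hsum ω) hδ)
    _ = 1 - (1 - δ) * ∑ i ∈ s, ∫ ω, F i ω ∂μ := by
        rw [integral_sub (integrable_const _) hsumint, integral_const_mul,
          integral_finsetSum s hint]
        simp

variable {S : Type*} [DecidableEq S] [Fintype S]

variable (S) in
/-- The event that a vertex at distance `n` from the root is visited by particles that have only
stepped away from the root. -/
def levelVisited (n : ℕ) : Set (List S × ℕ → Option S) :=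
  {ξ | ∃ v ∈ level S n, (occupants ξ v).Nonempty}

lemma antitone_levelVisited : Antitone (levelVisited S) := by
  refine antitone_nat_of_succ_le fun n ξ hξ => ?_
  obtain ⟨v, hv, hne⟩ := hξ
  obtain ⟨hlen, hchain⟩ := mem_level.1 hv
  exact ⟨v.tail, mem_level.2 ⟨by rw [List.length_tail, hlen, Nat.add_sub_cancel], hchain.tail⟩,
    occupants_nonempty_tail hne⟩

lemma levelVisited_eq_biUnion (n : ℕ) :
    levelVisited S n = ⋃ v ∈ level S n, {ξ | (occupants ξ v).Nonempty} := by
  ext ξ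
  simp [levelVisited]

variable [MeasurableSpace (Option S)] [MeasurableSingletonClass (Option S)]

lemma measurableSet_levelVisited (n : ℕ) : MeasurableSet (levelVisited S n) := by
  rw [levelVisited_eq_biUnion]
  exact Finset.measurableSet_biUnion _ fun v _ => measurableSet_occupants_nonempty v

variable {κ : Measure (Option S)} [IsProbabilityMeasure κ] {q : ℝ}

section Extinction

variable (hκ : ∀ i, κ.real {some i} = q)
include hκ

lemma measureReal_levelVisited_succ_le {d : ℕ} (hS : Fintype.card S = d + 1) (n : ℕ) :
    (jumpFieldLaw κ).real (levelVisited S (n + 1)) ≤ (d + 1) * (d ^ n * meanHit q n q) := by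
  have hvertex : ∀ v ∈ level S (n + 1),
      (jumpFieldLaw κ).real {ξ | (occupants ξ v).Nonempty} = meanHit q n q := fun v hv => by
    rw [measureReal_occupants_nonempty hκ, (mem_level.1 hv).1, meanHit]
    ring_nf
  rw [levelVisited_eq_biUnion]
  refine (measureReal_biUnion_finset_le _ _).trans_eq ?_
  rw [Finset.sum_congr rfl hvertex, Finset.sum_const, card_level_succ, hS, nsmul_eq_mul]
  push_cast
  ring

theorem tendsto_measureReal_levelVisited {d : ℕ} (hS : Fintype.card S = d + 1) (hd : 1 ≤ d)
    (h0 : 0 ≤ q) (hdq : d * q < 1) (hsub : localizationSum d q < 1) :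
    Filter.Tendsto (fun n => (jumpFieldLaw κ).real (levelVisited S n)) Filter.atTop (nhds 0) := by
  have hlim := tendsto_pow_mul_meanHit (by exact_mod_cast hd) h0 hdq hsub
  rw [← Filter.tendsto_add_atTop_iff_nat 1]
  exact squeeze_zero (fun _ => measureReal_nonneg)
    (fun n => measureReal_levelVisited_succ_le hκ hS n)
    (by simpa using hlim.const_mul ((d : ℝ) + 1))

end Extinction

section Survival

variable {g : ℕ → ℝ}

lemma integral_prod_level_succ_le (hg : ∀ k, 0 ≤ g k)
    (hstep : ∀ (A : Finset (List S)) (l : List S), (∀ x ∈ A, x.length ≤ l.length) →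
      ∫ ξ, ∏ i ∈ awayDirections l, g (childOccupants ξ A i l).card ∂(jumpFieldLaw κ) ≤ g A.card)
    (n : ℕ) :
    ∫ ξ, ∏ v ∈ level S (n + 1), g (occupants ξ v).card ∂(jumpFieldLaw κ)
      ≤ ∫ ξ, ∏ v ∈ level S n, g (occupants ξ v).card ∂(jumpFieldLaw κ) := by
  have hlen : ∀ (ξ : List S × ℕ → Option S) (l : List S), ∀ x ∈ occupants ξ l,
      x.length ≤ l.length := fun _ _ _ => length_le_of_mem_occupants
  have hchildren : ∀ (A : Finset (List S)) (l : List S),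
      DependsOn (fun η : List S × ℕ → Option S =>
        ∏ i ∈ awayDirections l, g (childOccupants η A i l).card) (jumpsAt A l.length : Set _) :=
    fun A l η η' h => Finset.prod_congr rfl fun i _ => by rw [childOccupants_eq_of_eqOn h]
  have hpast : ∀ {ξ ξ' : List S × ℕ → Option S}, (∀ a ∈ (jumpsBefore S n : Set _), ξ a = ξ' a) →
      ∀ v ∈ level S n, occupants ξ v = occupants ξ' v := fun h v hv =>
    occupants_eq_of_eqOn (by rwa [(mem_level.1 hv).1])
  simp only [prod_level_succ, occupants]
  rw [integral_diag_of_dependsOn (P := jumpsBefore S n)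
    (L := jumpsBefore S (n + 1) \ jumpsBefore S n)
    (G := fun ξ η => ∏ l ∈ level S n, ∏ i ∈ awayDirections l,
      g (childOccupants η (occupants ξ l) i l).card) Finset.disjoint_sdiff
    (fun η ξ ξ' h => Finset.prod_congr rfl fun l hl => by simp only [hpast h l hl])
    fun ξ η η' h => Finset.prod_congr rfl fun l hl => hchildren _ l fun a ha =>
      h a (Finset.coe_subset.2 ((mem_level.1 hl).1 ▸ jumpsAt_subset (hlen ξ l)) ha)]
  refine integral_mono_of_nonneg (.of_forall fun ξ => integral_nonneg fun η =>
      Finset.prod_nonneg fun l _ => Finset.prod_nonneg fun i _ => hg _)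
    (integrable_of_dependsOn (P := jumpsBefore S n) fun ξ ξ' h =>
      Finset.prod_congr rfl fun v hv => by rw [hpast h v hv])
    (.of_forall fun ξ => ?_)
  dsimp only
  rw [integral_prod_of_dependsOn (A := fun l => jumpsAt (occupants ξ l) l.length) ?_
    fun l _ => hchildren _ l]
  · exact Finset.prod_le_prod (fun l _ => integral_nonneg fun η =>
      Finset.prod_nonneg fun i _ => hg _) fun l _ => hstep _ l (hlen ξ l)
  · refine fun l hl l' hl' hll => Finset.disjoint_left.2 fun a ha ha' => hll ?_
    obtain ⟨x, hx, rfl⟩ := Finset.mem_image.1 ha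
    obtain ⟨x', hx', h⟩ := Finset.mem_image.1 ha'
    obtain rfl : x' = x := congrArg Prod.fst h
    exact eq_of_mem_occupants ((mem_level.1 hl).1.trans (mem_level.1 hl').1.symm) hx hx'

lemma one_sub_le_measureReal_levelVisited (hg : ∀ k, 0 ≤ g k) (hg0 : g 0 = 1)
    (hstep : ∀ (A : Finset (List S)) (l : List S), (∀ x ∈ A, x.length ≤ l.length) →
      ∫ ξ, ∏ i ∈ awayDirections l, g (childOccupants ξ A i l).card ∂(jumpFieldLaw κ) ≤ g A.card)
    (n : ℕ) : 1 - g 1 ≤ (jumpFieldLaw κ).real (levelVisited S n) := by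
  have hmeas := (measurableSet_levelVisited (S := S) n).compl
  have hmean : ∫ ξ, ∏ v ∈ level S n, g (occupants ξ v).card ∂(jumpFieldLaw κ) ≤ g 1 := by
    induction n with
    | zero => simp [level, occupants]
    | succ n ih =>
      exact (integral_prod_level_succ_le hg hstep n).trans (ih (measurableSet_levelVisited n).compl)
  have hcompl : (jumpFieldLaw κ).real (levelVisited S n)ᶜ
      ≤ ∫ ξ, ∏ v ∈ level S n, g (occupants ξ v).card ∂(jumpFieldLaw κ) := by
    rw [← integral_indicator_one hmeas]
    refine integral_mono_of_nonneg (.of_forall (Set.indicator_nonneg fun _ _ => zero_le_one))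
      (integrable_of_dependsOn (P := jumpsBefore S n) fun ξ ξ' h => Finset.prod_congr rfl
        fun v hv => by rw [occupants_eq_of_eqOn (by rwa [(mem_level.1 hv).1])])
      (.of_forall (Set.indicator_le' (fun ξ hξ => ?_) fun ξ _ =>
        Finset.prod_nonneg fun v _ => hg _))
    refine (Finset.prod_eq_one fun v hv => ?_).ge
    rw [Finset.not_nonempty_iff_eq_empty.1 fun hne => hξ ⟨v, hv, hne⟩, Finset.card_empty, hg0]
  rw [probReal_compl_eq_one_sub hmeas.of_compl] at hcompl
  linarith

variable (hκ : ∀ i, κ.real {some i} = q)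
include hκ

lemma integral_prod_awayDirections_le {d m : ℕ} (hS : Fintype.card S = d + 1) (h0 : 0 ≤ q)
    (h1 : q ≤ 1) {ε C θ : ℝ} (hε : 0 < ε)
    (hexp : ∀ k, (1 + ε) * eigenFun d q m k ≤ d * meanEigenFun d q m k)
    (hC : ∀ k, eigenFun d q m k ≤ C) (hθ : 0 ≤ θ) (hθC : (d + 1) * (θ * C) = ε / (1 + ε))
    {A : Finset (List S)} {l : List S} (hA : ∀ x ∈ A, x.length ≤ l.length) :
    ∫ ξ, ∏ i ∈ awayDirections l, (1 - θ * eigenFun d q m (childOccupants ξ A i l).card)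
      ∂(jumpFieldLaw κ) ≤ 1 - θ * eigenFun d q m A.card := by
  have hnonneg := eigenFun_nonneg (b := d) d.cast_nonneg h0 h1 m
  have hθf : ∀ k, 0 ≤ θ * eigenFun d q m k := fun k => mul_nonneg hθ (hnonneg k)
  have hcard : (d : ℝ) ≤ (awayDirections l).card := by
    exact_mod_cast (by simpa [hS] using card_sub_one_le_card_awayDirections l)
  have hsum : ∀ ξ, ∑ i ∈ awayDirections l, θ * eigenFun d q m (childOccupants ξ A i l).card
      ≤ ε / (1 + ε) := fun ξ => by
    rw [← hθC]
    refine (Finset.sum_le_card_nsmul _ _ (θ * C) fun i _ =>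
      mul_le_mul_of_nonneg_left (hC _) hθ).trans ?_
    rw [nsmul_eq_mul]
    refine mul_le_mul_of_nonneg_right ?_ (mul_nonneg hθ ((hnonneg 0).trans (hC 0)))
    exact_mod_cast (Finset.card_le_univ _).trans_eq hS
  calc _ ≤ 1 - (1 - ε / (1 + ε)) * ∑ i ∈ awayDirections l,
          ∫ ξ, θ * eigenFun d q m (childOccupants ξ A i l).card ∂(jumpFieldLaw κ) :=
        integral_prod_one_sub_le (fun _ _ _ => hθf _) hsum
          (div_le_one_of_le₀ (by linarith) (by linarith)) fun i _ =>
          integrable_comp_childOccupants (fun B => θ * eigenFun d q m B.card) A i l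
    _ = 1 - θ / (1 + ε) * ((awayDirections l).card * meanEigenFun d q m A.card) := by
        simp only [integral_const_mul, integral_eigenFun_card_childOccupants hκ d m hA,
          Finset.sum_const, nsmul_eq_mul]
        field_simp
        ring
    _ ≤ 1 - θ / (1 + ε) * ((1 + ε) * eigenFun d q m A.card) := by
        have hmean := meanEigenFun_nonneg (b := d) d.cast_nonneg h0 h1 m A.card
        exact sub_le_sub_left (mul_le_mul_of_nonneg_left
          ((hexp _).trans (mul_le_mul_of_nonneg_right hcard hmean)) (by positivity)) 1
    _ = 1 - θ * eigenFun d q m A.card := by field_simp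

theorem exists_pos_le_measureReal_levelVisited {d : ℕ} (hS : Fintype.card S = d + 1) (hd : 1 ≤ d)
    (h0 : 0 < q) (hdq : d * q < 1) (hsuper : 1 < localizationSum d q) :
    ∃ δ > 0, ∀ n, δ ≤ (jumpFieldLaw κ).real (levelVisited S n) := by
  have hd' : (1 : ℝ) ≤ d := by exact_mod_cast hd
  have h1 : q ≤ 1 := by nlinarith
  obtain ⟨m, hm, ε, hε, hexp⟩ := exists_expanding_eigenFun hd' h0 hdq hsuper
  set C := ∑ i ∈ Finset.range m, eigenCoeff d q i
  have hC : ∀ k, eigenFun d q m k ≤ C := eigenFun_le d.cast_nonneg h0.le h1 m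
  have hpos : 0 < eigenFun d q m 1 := eigenFun_one_pos d.cast_nonneg h0 h1 hm
  have hC0 : 0 < C := hpos.trans_le (hC 1)
  set θ := ε / (1 + ε) / ((d + 1) * C) with hθ
  have hθ0 : 0 < θ := by positivity
  have hθC : (d + 1) * (θ * C) = ε / (1 + ε) := by rw [hθ]; field_simp
  have hθC1 : θ * C ≤ 1 := by
    have : ε / (1 + ε) ≤ 1 := div_le_one_of_le₀ (by linarith) (by linarith)
    nlinarith [mul_pos hθ0 hC0]
  refine ⟨θ * eigenFun d q m 1, by positivity, fun n => ?_⟩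
  have := one_sub_le_measureReal_levelVisited (κ := κ) (g := fun k => 1 - θ * eigenFun d q m k)
    (fun k => sub_nonneg.2 ((mul_le_mul_of_nonneg_left (hC k) hθ0.le).trans hθC1))
    (by simp [eigenFun_zero])
    (fun A l hA => integral_prod_awayDirections_le hκ hS h0.le h1 hε hexp hC hθ0.le hθC hA) n
  simpa using this

end Survival

end Phases

/-! ### Lifetimes and walks from independent jumps -/

section InfiniteProduct

variable {I X Y : Type*} [MeasurableSpace X] [MeasurableSpace Y]

lemma measurePreserving_zip_infinitePi (μ : Measure X) (ν : Measure Y) [IsProbabilityMeasure μ]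
    [IsProbabilityMeasure ν] :
    MeasurePreserving (fun (z : (I → X) × (I → Y)) i => (z.1 i, z.2 i))
      ((Measure.infinitePi fun _ => μ).prod (Measure.infinitePi fun _ => ν))
      (Measure.infinitePi fun _ => μ.prod ν) := by
  have hzip : Measurable fun (z : (I → X) × (I → Y)) i => (z.1 i, z.2 i) := by fun_prop
  refine ⟨hzip, (Measure.isProjectiveLimit_infinitePi _).unique (fun s => ?_) |>.symm⟩
  have hfinite := (measurePreserving_arrowProdEquivProdArrow X Y s (fun _ => μ)
    (fun _ => ν)).symm.map_eq
  rw [← Measure.infinitePi_map_restrict (μ := fun _ : I => μ),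
    ← Measure.infinitePi_map_restrict (μ := fun _ : I => ν),
    Measure.map_prod_map _ _ (by fun_prop) (by fun_prop),
    Measure.map_map (by fun_prop) (by fun_prop)] at hfinite
  rw [Measure.map_map (by fun_prop) hzip, ← hfinite]
  rfl

lemma ae_exists_notMem_of_injective {μ : Measure X} [IsProbabilityMeasure μ] {t : Set X}
    (ht : MeasurableSet t) (hμt : μ t < 1) {f : ℕ → I} (hf : Function.Injective f) :
    ∀ᵐ ξ ∂(Measure.infinitePi fun _ => μ), ∃ k, ξ (f k) ∉ t := by
  refine le_antisymm (ge_of_tendsto' (ENNReal.tendsto_pow_atTop_nhds_zero_of_lt_one hμt)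
    fun n => ?_) zero_le
  calc (Measure.infinitePi fun _ => μ) {ξ | ∃ k, ξ (f k) ∉ t}ᶜ
      ≤ (Measure.infinitePi fun _ => μ)
          (Set.pi ((Finset.range n).map ⟨f, hf⟩ : Set I) fun _ => t) :=
        measure_mono fun ξ hξ i hi => by
          obtain ⟨k, -, rfl⟩ := Finset.mem_map.1 (Finset.mem_coe.1 hi)
          exact not_not.1 fun h => hξ ⟨k, h⟩
    _ = μ t ^ n := by
        rw [Measure.infinitePi_pi _ fun _ _ => ht, Finset.prod_const, Finset.card_map,
          Finset.card_range]

end InfiniteProduct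

section FirstFalse

/-- The index of the first `false`; it is `0` for the sequence that is constantly `true`. -/
noncomputable def firstFalse (b : ℕ → Bool) : ℕ := sInf {k | b k = false}

variable {b : ℕ → Bool} {n : ℕ}

lemma firstFalse_eq_iff (hb : ∃ k, b k = false) :
    firstFalse b = n ↔ (∀ k < n, b k = true) ∧ b n = false := by
  constructor
  · rintro rfl
    exact ⟨fun k hk => by simpa using Nat.notMem_of_lt_sInf hk, Nat.sInf_mem hb⟩
  · rintro ⟨htrue, hfalse⟩
    refine le_antisymm (Nat.sInf_le hfalse) (le_csInf ⟨n, hfalse⟩ fun k hk => ?_)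
    refine not_lt.1 fun hlt => ?_
    exact Bool.false_ne_true (hk.symm.trans (htrue k hlt))

lemma lt_firstFalse_iff :
    n < firstFalse b ↔ (∃ k, b k = false) ∧ ∀ k ≤ n, b k = true := by
  constructor
  · refine fun h => ⟨Nat.nonempty_of_pos_sInf (n.zero_le.trans_lt h), fun k hk => ?_⟩
    simpa using Nat.notMem_of_lt_sInf (hk.trans_lt h)
  · rintro ⟨hb, htrue⟩
    refine not_le.1 fun hle => Bool.false_ne_true ?_
    rw [← ((firstFalse_eq_iff hb).1 rfl).2, htrue _ hle]

@[fun_prop]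
lemma measurable_firstFalse : Measurable firstFalse := by
  refine measurable_of_Ioi fun n => ?_
  simp only [Set.preimage, Set.mem_Ioi, lt_firstFalse_iff]
  measurability

variable {p : unitInterval}

lemma bernoulliMeasure_true_false_singleton_true :
    bernoulliMeasure true false p {true} = ENNReal.ofReal p := by
  rw [← ofReal_measureReal, bernoulliMeasure_real_apply_of_mem_of_notMem] <;> simp

lemma bernoulliMeasure_true_false_singleton_false :
    bernoulliMeasure true false p {false} = ENNReal.ofReal (1 - p) := by
  rw [← ofReal_measureReal, bernoulliMeasure_real_apply_of_notMem_of_mem] <;> simp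

lemma map_firstFalse (hp : (p : ℝ) < 1) :
    (Measure.infinitePi fun _ : ℕ => bernoulliMeasure true false p).map firstFalse =
      geometricMeasure (unitInterval.symm p) := by
  have hsymm : unitInterval.symm p ≠ 0 := by
    rw [Ne, unitInterval.symm_eq_zero]
    rintro rfl
    exact lt_irrefl _ hp
  have hcylinder : ∀ n : ℕ, firstFalse ⁻¹' {n} =ᵐ[Measure.infinitePi fun _ : ℕ =>
      bernoulliMeasure true false p]
      Set.pi (Finset.range (n + 1) : Set ℕ) fun k => {decide (k < n)} := fun n => by
    filter_upwards [ae_exists_notMem_of_injective (measurableSet_singleton true)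
      (by rw [bernoulliMeasure_true_false_singleton_true]; simpa using hp)
      Function.injective_id] with b hb
    refine propext ?_
    change firstFalse b = n ↔ b ∈ Set.pi _ _
    rw [firstFalse_eq_iff (by simpa using hb)]
    simp only [Set.mem_pi, Finset.mem_coe, Finset.mem_range, Set.mem_singleton_iff,
      Order.lt_add_one_iff]
    refine ⟨fun h k hk => ?_, fun h => ⟨fun k hk => ?_, ?_⟩⟩
    · obtain hlt | rfl := hk.lt_or_eq
      · simpa [hlt] using h.1 k hlt
      · simpa using h.2
    · simpa [hk] using h k hk.le
    · simpa using h n le_rfl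
  refine Measure.ext_of_singleton fun n => ?_
  rw [geometricMeasure_singleton hsymm, Measure.map_apply measurable_firstFalse
    (measurableSet_singleton n), measure_congr (hcylinder n),
    Measure.infinitePi_pi _ (fun _ _ => measurableSet_singleton _), Finset.prod_range_succ,
    Finset.prod_congr rfl (g := fun _ => ENNReal.ofReal p)]
  · rw [decide_eq_false (lt_irrefl n), bernoulliMeasure_true_false_singleton_false]
    simp [ENNReal.ofReal_mul, ENNReal.ofReal_pow p.2.1, p.2.1]
  · intro k hk
    rw [decide_eq_true (Finset.mem_range.1 hk), bernoulliMeasure_true_false_singleton_true]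

end FirstFalse

section JumpLaw

variable {d : ℕ} {p : unitInterval}

/-- The law of one attempted jump: whether the particle lives long enough to make it, and a uniform
direction. -/
noncomputable def jumpTrialLaw (d : ℕ) (p : unitInterval) : Measure (Bool × Fin (d + 1)) :=
  (bernoulliMeasure true false p).prod (uniformOn Set.univ)

instance : IsProbabilityMeasure (jumpTrialLaw d p) := by
  unfold jumpTrialLaw
  infer_instance

/-- The direction of an attempted jump, or `none` if the particle dies instead. -/
def jumpDirection (a : Bool × Fin (d + 1)) : Option (Fin (d + 1)) :=
  if a.1 then some a.2 else none

/-- The lifetime and the directions of a particle that dies at its first failed attempt to jump. -/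
noncomputable def particleOf (b : ℕ → Bool × Fin (d + 1)) : ℕ × (ℕ → Fin (d + 1)) :=
  (firstFalse fun k => (b k).1, fun k => (b k).2)

@[fun_prop]
lemma measurable_particleOf : Measurable (particleOf (d := d)) := by
  unfold particleOf
  fun_prop

lemma map_particleOf (hp : (p : ℝ) < 1) :
    (Measure.infinitePi fun _ : ℕ => jumpTrialLaw d p).map particleOf =
      (geometricMeasure (unitInterval.symm p)).prod
        (Measure.infinitePi fun _ : ℕ => uniformOn (Set.univ : Set (Fin (d + 1)))) := by
  have hzip := measurePreserving_zip_infinitePi (I := ℕ) (bernoulliMeasure true false p)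
    (uniformOn (Set.univ : Set (Fin (d + 1))))
  have hprod := Measure.map_prod_map (Measure.infinitePi fun _ : ℕ => bernoulliMeasure true false p)
    (Measure.infinitePi fun _ : ℕ => uniformOn (Set.univ : Set (Fin (d + 1))))
    measurable_firstFalse measurable_id
  rw [map_firstFalse hp, Measure.map_id] at hprod
  unfold jumpTrialLaw
  rw [hprod, ← hzip.map_eq, Measure.map_map measurable_particleOf hzip.measurable]
  rfl

/-- The outcome that is encoded by a field of attempted jumps. -/
noncomputable def outcomeOf (ζ : List (Fin (d + 1)) × ℕ → Bool × Fin (d + 1)) : Outcome d :=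
  fun x => particleOf fun k => ζ (x.1, k)

lemma measurable_outcomeOf : Measurable (outcomeOf (d := d)) := by
  unfold outcomeOf
  fun_prop

lemma map_outcomeOf (hp : (p : ℝ) < 1) :
    (Measure.infinitePi fun _ => jumpTrialLaw d p).map outcomeOf = law d p := by
  have hparticles := Measure.infinitePi_map_pi
    (fun _ : Vertex d => Measure.infinitePi fun _ : ℕ => jumpTrialLaw d p)
    fun _ => measurable_particleOf
  simp only [map_particleOf hp] at hparticles
  have hvertices := Measure.map_infinitePi_infinitePi_of_inj
    (P := fun _ : List (Fin (d + 1)) => Measure.infinitePi fun _ : ℕ => jumpTrialLaw d p)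
    (f := fun x : Vertex d => x.1) Subtype.val_injective
  have hcurry := Measure.infinitePi_map_curry
    (fun (_ : List (Fin (d + 1))) (_ : ℕ) => jumpTrialLaw d p)
  rw [law, ← hparticles, ← hvertices, ← hcurry, Measure.map_map (by fun_prop) (by fun_prop),
    Measure.map_map (by fun_prop) (by fun_prop)]
  rfl

lemma ae_exists_failure (hp : (p : ℝ) < 1) :
    ∀ᵐ ζ ∂(Measure.infinitePi fun _ => jumpTrialLaw d p),
      ∀ x : List (Fin (d + 1)), ∃ k : ℕ, (ζ (x, k)).1 = false := by
  have hlt : jumpTrialLaw d p ({true} ×ˢ Set.univ) < 1 := by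
    rw [jumpTrialLaw, Measure.prod_prod, bernoulliMeasure_true_false_singleton_true]
    simpa using hp
  refine ae_all_iff.2 fun x => ?_
  filter_upwards [ae_exists_notMem_of_injective (.of_discrete) hlt
    (Prod.mk_right_injective x)] with ζ hζ
  simpa using hζ

lemma jumpOf_outcomeOf {ζ : List (Fin (d + 1)) × ℕ → Bool × Fin (d + 1)} {x : List (Fin (d + 1))}
    {k : ℕ} (hζ : ∃ k, (ζ (x, k)).1 = false) (hx : x.IsChain (fun a b => a ≠ b))
    (halive : ∀ j < k, jumpDirection (ζ (x, j)) ≠ none) :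
    jumpOf (outcomeOf ζ) (x, k) = jumpDirection (ζ (x, k)) := by
  have hlife : k < lifetime (outcomeOf ζ) ⟨x, hx⟩ ↔ (ζ (x, k)).1 = true := by
    refine lt_firstFalse_iff.trans ⟨fun h => h.2 k le_rfl, fun hk => ⟨hζ, fun j hj => ?_⟩⟩
    obtain hlt | rfl := hj.lt_or_eq
    · simpa [jumpDirection] using halive j hlt
    · exact hk
  simp only [jumpOf, hx, dite_true, hlife, jumpDirection]
  rfl

lemma outcomeOf_mem_survival_iff {ζ : List (Fin (d + 1)) × ℕ → Bool × Fin (d + 1)}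
    (hζ : ∀ x, ∃ k, (ζ (x, k)).1 = false) :
    outcomeOf ζ ∈ survival d ↔
      (fun a => jumpDirection (ζ a)) ∈ ⋂ n, levelVisited (Fin (d + 1)) n := by
  rw [mem_survival_iff, Set.mem_iInter]
  refine forall_congr' fun t => exists_congr fun v => and_congr_right fun hv => ?_
  rw [← occupants_congr (J := fun a => jumpDirection (ζ a)) fun x hx k _ halive =>
    (jumpOf_outcomeOf (hζ x) ((mem_level.1 hv).2.suffix hx) halive).symm]

local instance : MeasurableSpace (Option (Fin (d + 1))) := ⊤

lemma measurable_jumpOf : Measurable (jumpOf (d := d)) := by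
  refine measurable_pi_lambda _ fun ⟨x, k⟩ => ?_
  by_cases hx : x.IsChain (fun a b => a ≠ b)
  · simp only [jumpOf, hx, dite_true]
    refine Measurable.ite ?_ (measurable_from_top.comp (by fun_prop)) measurable_const
    exact measurableSet_lt measurable_const (by unfold lifetime; fun_prop)
  · simp only [jumpOf, hx, dite_false]
    exact measurable_const

lemma measurableSet_survival : MeasurableSet (survival d) := by
  have hsurvival : survival d = jumpOf ⁻¹' ⋂ n, levelVisited (Fin (d + 1)) n := by
    ext ω
    simp [mem_survival_iff, levelVisited]
  rw [hsurvival]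
  exact measurable_jumpOf (.iInter measurableSet_levelVisited)

/-- The law of one jump: `none` if the particle dies, and otherwise a uniform direction. -/
noncomputable def jumpLaw (d : ℕ) (p : unitInterval) : Measure (Option (Fin (d + 1))) :=
  (jumpTrialLaw d p).map jumpDirection

instance : IsProbabilityMeasure (jumpLaw d p) :=
  Measure.isProbabilityMeasure_map (measurable_of_countable _).aemeasurable

lemma jumpLaw_real_singleton_some (i : Fin (d + 1)) :
    (jumpLaw d p).real {some i} = p / (d + 1) := by
  have hpreimage : jumpDirection ⁻¹' {some i} = ({true} ×ˢ {i} : Set (Bool × Fin (d + 1))) := by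
    ext ⟨b, k⟩
    cases b <;> simp [jumpDirection]
  have hcard : ((d : ENNReal) + 1).toReal = d + 1 := by
    rw [← Nat.cast_add_one, ENNReal.toReal_natCast, Nat.cast_add_one]
  rw [jumpLaw, map_measureReal_apply (measurable_of_countable _) (measurableSet_singleton _),
    hpreimage, jumpTrialLaw, measureReal_prod_prod, measureReal_def, measureReal_def,
    bernoulliMeasure_true_false_singleton_true, uniformOn_univ]
  simp [p.2.1, div_eq_mul_inv, hcard]

lemma survivalProb_eq (hp : (p : ℝ) < 1) :
    survivalProb d p = (jumpFieldLaw (jumpLaw d p)).real (⋂ n, levelVisited (Fin (d + 1)) n) := by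
  have hmap := Measure.infinitePi_map_pi (fun _ : List (Fin (d + 1)) × ℕ => jumpTrialLaw d p)
    fun _ => measurable_of_countable jumpDirection
  have hfield : Measurable fun (ζ : List (Fin (d + 1)) × ℕ → Bool × Fin (d + 1)) a =>
      jumpDirection (ζ a) :=
    measurable_pi_lambda _ fun a =>
      (measurable_of_countable jumpDirection).comp (measurable_pi_apply a)
  rw [survivalProb, ← map_outcomeOf hp, map_measureReal_apply measurable_outcomeOf
    measurableSet_survival, jumpFieldLaw, jumpLaw, ← hmap,
    map_measureReal_apply hfield (.iInter measurableSet_levelVisited)]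
  refine measureReal_congr ?_
  filter_upwards [ae_exists_failure hp] with ζ hζ
  exact propext (outcomeOf_mem_survival_iff hζ)

lemma mul_div_add_one_lt_one (hp : (p : ℝ) < 1) : (d : ℝ) * (p / (d + 1)) < 1 := by
  rw [mul_div_assoc', div_lt_one (by positivity)]
  nlinarith [p.2.1, (Nat.cast_nonneg d : (0 : ℝ) ≤ d)]

theorem survivalProb_eq_zero (hd : 1 ≤ d) (hp : (p : ℝ) < 1)
    (hsub : localizationSum d (p / (d + 1)) < 1) : survivalProb d p = 0 := by
  have hlim := tendsto_measureReal_levelVisited (κ := jumpLaw d p) jumpLaw_real_singleton_some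
    (Fintype.card_fin _) hd (div_nonneg p.2.1 (by positivity)) (mul_div_add_one_lt_one hp) hsub
  rw [survivalProb_eq hp]
  exact le_antisymm
    (ge_of_tendsto' hlim fun n => measureReal_mono (Set.iInter_subset _ n)) measureReal_nonneg

theorem survivalProb_pos (hd : 1 ≤ d) (hp0 : 0 < (p : ℝ)) (hp : (p : ℝ) < 1)
    (hsuper : 1 < localizationSum d (p / (d + 1))) : 0 < survivalProb d p := by
  obtain ⟨δ, hδ, hle⟩ := exists_pos_le_measureReal_levelVisited (κ := jumpLaw d p)
    jumpLaw_real_singleton_some (Fintype.card_fin _) hd (by positivity)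
    (mul_div_add_one_lt_one hp) hsuper
  have hlim := tendsto_measure_iInter_atTop (μ := jumpFieldLaw (jumpLaw d p))
    (fun n => (measurableSet_levelVisited n).nullMeasurableSet) antitone_levelVisited
    ⟨0, measure_ne_top _ _⟩
  rw [survivalProb_eq hp]
  exact hδ.trans_le (ge_of_tendsto' ((ENNReal.tendsto_toReal (measure_ne_top _ _)).comp hlim) hle)

end JumpLaw

/-! ### The critical parameter -/

section CriticalParameter

variable {d : ℕ} {q : ℝ}

lemma criticalParameter_eq (hd : 2 ≤ d) (h0 : 0 ≤ q) (h1 : ((d : ℝ) + 1) * q < 1)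
    (hq : localizationSum d q = 1) : criticalParameter d = (d + 1) * q := by
  have hb : (2 : ℝ) ≤ d := mod_cast hd
  have hd0 : (0 : ℝ) < d + 1 := by positivity
  have hsuper : Set.Ioo ((d + 1) * q) 1 ⊆
      {x : ℝ | ∃ p : unitInterval, (p : ℝ) = x ∧ 0 < x ∧ x < 1 ∧ 0 < survivalProb d p} := by
    rintro x ⟨hqx, hx1⟩
    have hx0 : 0 < x := (by positivity : 0 ≤ (d + 1) * q).trans_lt hqx
    lift x to unitInterval using ⟨hx0.le, hx1.le⟩
    refine ⟨x, rfl, hx0, hx1, survivalProb_pos (by omega) hx0 hx1 (hq.symm.trans_lt ?_)⟩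
    exact localizationSum_strictMono hb h0 ((lt_div_iff₀' hd0).2 hqx) (mul_div_add_one_lt_one hx1)
  refine ((isGLB_Ioo h1).of_subset_of_superset isGLB_Ici hsuper ?_).csInf_eq
    ((Set.nonempty_Ioo.2 h1).mono hsuper)
  rintro x ⟨p, rfl, hp0, hp1, hpos⟩
  refine Set.mem_Ici.2 (not_lt.1 fun hlt => hpos.ne' ?_)
  refine survivalProb_eq_zero (by omega) hp1 (lt_of_lt_of_eq ?_ hq)
  exact localizationSum_strictMono hb (by positivity) ((div_lt_iff₀' hd0).2 hlt) (by linarith)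

theorem criticalParameter_spec (hd : 2 ≤ d) (h0 : 0 < q) (h1 : ((d : ℝ) + 1) * q < 1)
    (hq : localizationSum d q = 1) :
    criticalParameter d ∈ Set.Ioo (0 : ℝ) 1 ∧
      LocalizationEq d 1 (criticalParameter d / ((d : ℝ) + 1)) ∧
      ∀ p : ℝ, 0 < p → p < ((d : ℝ) + 1) / (d : ℝ) →
        LocalizationEq d 1 (p / ((d : ℝ) + 1)) → p = criticalParameter d := by
  have hb : (2 : ℝ) ≤ d := mod_cast hd
  have hd0 : (0 : ℝ) < d + 1 := by positivity
  have hdq : (d : ℝ) * q < 1 := by linarith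
  rw [criticalParameter_eq hd h0.le h1 hq, mul_div_cancel_left₀ _ hd0.ne']
  refine ⟨⟨by positivity, h1⟩, (localizationEq_one_iff (by omega) h0.le hdq).2 hq, ?_⟩
  intro p hp0 hpd hp
  obtain ⟨r, rfl⟩ : ∃ r, p = (d + 1) * r := ⟨p / (d + 1), (mul_div_cancel₀ _ hd0.ne').symm⟩
  rw [mul_div_cancel_left₀ _ hd0.ne'] at hp
  have hr0 : 0 ≤ r := (pos_of_mul_pos_right hp0 hd0.le).le
  have hdr : (d : ℝ) * r < 1 := by
    rw [← mul_one_div, mul_lt_mul_iff_right₀ hd0] at hpd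
    exact (lt_div_iff₀' (by linarith)).1 hpd
  have hr := (localizationEq_one_iff (by omega) hr0 hdr).1 hp
  congr 1
  obtain hlt | heq | hgt := lt_trichotomy r q
  · exact absurd (hr.trans hq.symm) (localizationSum_strictMono hb hr0 hlt hdq).ne
  · exact heq
  · exact absurd (hq.trans hr.symm) (localizationSum_strictMono hb h0.le hgt hdr).ne

lemma exists_localizationSum_natCast_eq_one (hd : 2 ≤ d) :
    ∃ q : ℝ, 0 < q ∧ ((d : ℝ) + 1) * q < 1 ∧ localizationSum d q = 1 := by
  obtain rfl | hd := hd.eq_or_lt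
  · obtain ⟨q, hq, hroot⟩ := exists_localizationSum_two_eq_one
    exact ⟨q, by linarith [hq.1], by push_cast; linarith [hq.2], mod_cast hroot⟩
  · have hb : (3 : ℝ) ≤ d := mod_cast hd
    obtain ⟨q, hq, hroot⟩ := exists_localizationSum_eq_one_of_three_le hb
    refine ⟨q, (one_div_pos.2 (by linarith)).trans_le hq.1, ?_, hroot⟩
    exact (mul_le_mul_of_nonneg_left hq.2 (by positivity)).trans_lt
      (add_one_mul_upperRoot_lt_one hb)

theorem criticalParameter_two_mem_Icc : criticalParameter 2 ∈ Set.Icc 0.8 0.831619 := by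
  obtain ⟨q, hq, hroot⟩ := exists_localizationSum_two_eq_one
  rw [criticalParameter_eq le_rfl (by linarith [hq.1]) (by push_cast; linarith [hq.2])
    (mod_cast hroot)]
  constructor <;> push_cast <;> linarith [hq.1, hq.2]

theorem criticalParameter_mem_Icc (hd : 3 ≤ d) :
    criticalParameter d ∈
      Set.Icc (((d : ℝ) + 1) / (2 * (d : ℝ) - 1 / 4)) ((d + 1) * upperRoot d) := by
  have hb : (3 : ℝ) ≤ d := mod_cast hd
  have hd0 : (0 : ℝ) ≤ d + 1 := by positivity
  obtain ⟨q, hq, hroot⟩ := exists_localizationSum_eq_one_of_three_le hb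
  have hupper := mul_le_mul_of_nonneg_left hq.2 hd0
  rw [criticalParameter_eq (by omega) ((one_div_pos.2 (by linarith)).le.trans hq.1)
    (hupper.trans_lt (add_one_mul_upperRoot_lt_one hb)) hroot]
  exact ⟨by simpa only [mul_one_div] using mul_le_mul_of_nonneg_left hq.1 hd0, hupper⟩

end CriticalParameter
end FrogRemoval

theorem mainTheorem7 :
    (∀ d : ℕ, 2 ≤ d →
      FrogRemoval.criticalParameter d ∈ Set.Ioo (0 : ℝ) 1 ∧
      FrogRemoval.LocalizationEq d 1 (FrogRemoval.criticalParameter d / ((d : ℝ) + 1)) ∧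
      ∀ p : ℝ, 0 < p → p < ((d : ℝ) + 1) / (d : ℝ) →
        FrogRemoval.LocalizationEq d 1 (p / ((d : ℝ) + 1)) →
          p = FrogRemoval.criticalParameter d) ∧
    ((0.8 : ℝ) ≤ FrogRemoval.criticalParameter 2 ∧
      FrogRemoval.criticalParameter 2 ≤ (0.831619 : ℝ)) ∧
    (∀ d : ℕ, 3 ≤ d →
      ((d : ℝ) + 1) / (2 * (d : ℝ) - 1 / 4) ≤ FrogRemoval.criticalParameter d ∧
      FrogRemoval.criticalParameter d ≤
        ((d : ℝ) + 1) * (7 * (d : ℝ) - 1) *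
          (1 - Real.sqrt (1 - 14 / (7 * (d : ℝ) - 1) ^ 2)) / 2) := by
  refine ⟨fun d hd => ?_, FrogRemoval.criticalParameter_two_mem_Icc, fun d hd => ?_⟩
  · obtain ⟨q, h0, h1, hq⟩ := FrogRemoval.exists_localizationSum_natCast_eq_one hd
    exact FrogRemoval.criticalParameter_spec hd h0 h1 hq
  · obtain ⟨hlower, hupper⟩ := FrogRemoval.criticalParameter_mem_Icc hd
    refine ⟨hlower, hupper.trans_eq ?_⟩
    rw [FrogRemoval.upperRoot]
    ring
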